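/- Let $X=(X,d,\mu)$ be a metric space with a complete Borel measure $\mu$ (defined on the completion of the Borel $\sigma$-algebra) such that $0<\mu(B)<\infty$ for all open balls $B$. Assume that $\mu$ is (globally) doubling, i.e. there is $C$ such that $\mu(B(y,2r))\le C\mu(B(y,r))$ for all $y\in X$, $r>0$, and that $\mu$ supports a (global) $p_0$-Poincaré inequality for some $1\le p_0<p<\infty$, i.e. there are $C>0$, $\lambda\ge1$ such that $$\frac1{\mu(B)}\int_{B}|f-f_B|\,d\mu\le C\rho\Bigl(\frac1{\mu(\lambda B)}\int_{\lambda B}g^{p_0}\,d\mu\Bigr)^{1/p_0},\qquad f_B=\frac1{\mu(B)}\int_B f\,d\mu,$$ for all balls $B=B(y,\rho)$, $\lambda B=B(y,\lambda \rho)$, all integrable $f$ on $X$ and all upper gradients $g$ of $f$. Here a Borel function $g:X\to[0,\infty]$ is an upper gradient of $f$ if $|f(\gamma(0))-f(\gamma(\ell))|\le\int_\gamma g\,ds$ for every nonconstant compact rectifiable curve $\gamma:[0,\ell]\to X$ parametrized by arc length; a $\mu$-measurable $g:X\to[0,\infty]$ is a $p$-weak upper gradient of $f$ if this holds for all such curves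 outside a family $\Gamma$ of zero $p$-modulus (there is a Borel $\rho:X\to[0,\infty]$ with $\int_X\rho^p\,d\mu<\infty$ and $\int_\gamma\rho\,ds=\infty$ for all $\gamma\in\Gamma$). For $E\subset\Omega$, $\Omega$ open, let $$\operatorname{cap}_p(E,\Omega)=\inf_u\int_\Omega g_u^p\,d\mu,$$ where the infimum is over all measurable $u:X\to\mathbb R$ with $u\in L^p(X)$ having an upper gradient in $L^p(X)$, such that $u=0$ on $X\setminus\Omega$ and $u\ge1$ on $E$, and $g_u$ is the minimal $p$-weak upper gradient of $u$ (the $p$-weak upper gradient in $L^p(X)$ that is a.e. at most any other $p$-weak upper gradient in $L^p(X)$). Fix $x\in X$, write $B_r=B(x,r)$, and let $$\underline Q_0=\{q>0:\ \exists\, C_q>0:\ \tfrac{\mu(B_r)}{\mu(B_R)}\le C_q(\tfrac rR)^q\ \text{for } 0<r<R\le1\},$$ $$\overline Q_0=\{q>0:\ \exists\, C_q>0:\ \tfrac{\mu(B_r)}{\mu(B_R)}\ge C_q(\tfrac rR)^q\ \text{for } 0<r<R\le1\}.$$ Let $0<R_0<\frac14\operatorname{diam}X$. (a) If $p=\max\underline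 Q_0$, then there are constants $c,C>0$, independent of $r$ and $R$, such that for all $0<2r\le R\le R_0$ $$c\,\frac{\mu(B_r)}{r^p}\Bigl(\log\frac Rr\Bigr)^{1-p}\le\operatorname{cap}_p(B_r,B_R)\le C\,\frac{\mu(B_R)}{R^p}\Bigl(\log\frac Rr\Bigr)^{1-p}.$$ (b) If $p=\min\overline Q_0$, then there are constants $c,C>0$, independent of $r$ and $R$, such that for all $0<2r\le R\le R_0$ $$c\,\frac{\mu(B_R)}{R^p}\Bigl(\log\frac Rr\Bigr)^{1-p}\le\operatorname{cap}_p(B_r,B_R)\le C\,\frac{\mu(B_r)}{r^p}\Bigl(\log\frac Rr\Bigr)^{1-p}.$$ Moreover (for any $p>p_0$, without assuming $p=\max\underline Q_0$ or $p=\min\overline Q_0$): if the lower bound in (a) holds for some $c>0$ and all $0<2r\le R\le R_0$, then $p\le\sup\underline Q_0$; and if the lower bound in (b) holds for some $c>0$ and all $0<2r\le R\le R_0$, then $p\ge\inf\overline Q_0$. -/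

import Mathlib

open MeasureTheory Set Metric
open scoped ENNReal NNReal

/-- A nonconstant compact rectifiable curve in `X`, parametrized by arc length on `[0, len]`
(the values of `toFun` outside `[0, len]` play no role). -/
structure ArcCurve (X : Type*) [PseudoEMetricSpace X] where
  /-- the length of the curve -/
  len : ℝ
  len_pos : 0 < len
  /-- the arc length parametrization -/
  toFun : ℝ → X
  unitSpeed : HasUnitSpeedOn toFun (Icc 0 len)

/-- The line integral `∫_γ g ds`. -/
noncomputable def ArcCurve.lineIntegral {X : Type*} [PseudoEMetricSpace X]
    (γ : ArcCurve X) (g : X → ℝ≥0∞) : ℝ≥0∞ :=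
  ∫⁻ t in Icc 0 γ.len, g (γ.toFun t)

/-- The upper gradient inequality of the pair `(f, g)` along the curve `γ`. -/
def UpperGradientIneq {X : Type*} [PseudoEMetricSpace X]
    (f : X → ℝ) (g : X → ℝ≥0∞) (γ : ArcCurve X) : Prop :=
  ENNReal.ofReal |f (γ.toFun 0) - f (γ.toFun γ.len)| ≤ γ.lineIntegral g

/-- The Borel function `g : X → [0, ∞]` is an upper gradient of `f`. -/
def IsUpperGradient {X : Type*} [PseudoEMetricSpace X] [MeasurableSpace X]
    (f : X → ℝ) (g : X → ℝ≥0∞) : Prop :=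
  Measurable g ∧ ∀ γ : ArcCurve X, UpperGradientIneq f g γ

/-- The curve family `Γ` has zero `p`-modulus. -/
def ZeroModulus {X : Type*} [PseudoEMetricSpace X] [MeasurableSpace X]
    (μ : Measure X) (p : ℝ) (Γ : Set (ArcCurve X)) : Prop :=
  ∃ ρ : X → ℝ≥0∞, Measurable ρ ∧ ∫⁻ y, ρ y ^ p ∂μ < ∞ ∧ ∀ γ ∈ Γ, γ.lineIntegral ρ = ∞

/-- `g` is a `p`-weak upper gradient of `f`: it is measurable with respect to the completion of
`μ`, and the upper gradient inequality holds for `p`-almost every curve. -/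
def IsWeakUpperGradient {X : Type*} [PseudoEMetricSpace X] [MeasurableSpace X]
    (μ : Measure X) (p : ℝ) (f : X → ℝ) (g : X → ℝ≥0∞) : Prop :=
  AEMeasurable g μ ∧ ZeroModulus μ p {γ | ¬ UpperGradientIneq f g γ}

/-- `g` is (a representative of) the minimal `p`-weak upper gradient `g_f ∈ L^p(X)` of `f`. -/
def IsMinimalWeakUpperGradient {X : Type*} [PseudoEMetricSpace X] [MeasurableSpace X]
    (μ : Measure X) (p : ℝ) (f : X → ℝ) (g : X → ℝ≥0∞) : Prop :=
  IsWeakUpperGradient μ p f g ∧ ∫⁻ y, g y ^ p ∂μ < ∞ ∧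
    ∀ h : X → ℝ≥0∞, IsWeakUpperGradient μ p f h → ∫⁻ y, h y ^ p ∂μ < ∞ → g ≤ᵐ[μ] h

/-- `u` belongs to the Newtonian space `N^{1,p}(X)` (functions are defined everywhere). -/
def MemNewtonian {X : Type*} [PseudoEMetricSpace X] [MeasurableSpace X]
    (μ : Measure X) (p : ℝ) (u : X → ℝ) : Prop :=
  AEMeasurable u μ ∧ ∫⁻ y, ENNReal.ofReal |u y| ^ p ∂μ < ∞ ∧
    ∃ g : X → ℝ≥0∞, IsUpperGradient u g ∧ ∫⁻ y, g y ^ p ∂μ < ∞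

/-- `u` is admissible for `cap_p(E, Ω)`: it is in `N^{1,p}(X)`, vanishes outside `Ω`, and
`u ≥ 1` on `E`. -/
def CapAdmissible {X : Type*} [PseudoEMetricSpace X] [MeasurableSpace X]
    (μ : Measure X) (p : ℝ) (E Ω : Set X) (u : X → ℝ) : Prop :=
  MemNewtonian μ p u ∧ (∀ y ∉ Ω, u y = 0) ∧ ∀ y ∈ E, 1 ≤ u y

/-- The variational `p`-capacity `cap_p(E, Ω) = inf_u ∫_Ω g_u^p dμ`, the infimum taken over all
admissible `u`; the integral does not depend on the representative of `g_u`. -/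
noncomputable def varCap {X : Type*} [PseudoEMetricSpace X] [MeasurableSpace X]
    (μ : Measure X) (p : ℝ) (E Ω : Set X) : ℝ≥0∞ :=
  ⨅ (u : X → ℝ) (_ : CapAdmissible μ p E Ω u)
    (g : X → ℝ≥0∞) (_ : IsMinimalWeakUpperGradient μ p u g), ∫⁻ y in Ω, g y ^ p ∂μ

/-- `μ` is (globally) doubling. -/
def IsGloballyDoubling {X : Type*} [PseudoMetricSpace X] [MeasurableSpace X]
    (μ : Measure X) : Prop :=
  ∃ C : ℝ≥0, ∀ (x : X) (r : ℝ), 0 < r → μ (ball x (2 * r)) ≤ C * μ (ball x r)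

/-- `(X, μ)` supports a (global) `p`-Poincaré inequality. -/
def SupportsPoincare {X : Type*} [PseudoMetricSpace X] [MeasurableSpace X]
    (μ : Measure X) (p : ℝ) : Prop :=
  ∃ C lam : ℝ, 0 < C ∧ 1 ≤ lam ∧
    ∀ (x : X) (r : ℝ), 0 < r →
      ∀ f : X → ℝ, Integrable f μ → ∀ g : X → ℝ≥0∞, IsUpperGradient f g →
        ENNReal.ofReal (⨍ y in ball x r, |f y - ⨍ z in ball x r, f z ∂μ| ∂μ) ≤
          ENNReal.ofReal (C * r) * (⨍⁻ y in ball x (lam * r), g y ^ p ∂μ) ^ (1 / p)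

/-- The lower exponent set at `x`: all `q > 0` such that for some constant `C`,
`μ(B(x,r)) / μ(B(x,R)) ≤ C (r/R)^q` for `0 < r < R ≤ 1`. -/
def lowerQZero {X : Type*} [PseudoMetricSpace X] [MeasurableSpace X]
    (μ : Measure X) (x : X) : Set ℝ :=
  {q | 0 < q ∧ ∃ C : ℝ, 0 < C ∧ ∀ r R : ℝ, 0 < r → r < R → R ≤ 1 →
    μ.real (ball x r) / μ.real (ball x R) ≤ C * (r / R) ^ q}

/-- The upper exponent set at `x`: all `q > 0` such that for some constant `C > 0`,
`μ(B(x,r)) / μ(B(x,R)) ≥ C (r/R)^q` for `0 < r < R ≤ 1`. -/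
def upperQZero {X : Type*} [PseudoMetricSpace X] [MeasurableSpace X]
    (μ : Measure X) (x : X) : Set ℝ :=
  {q | 0 < q ∧ ∃ C : ℝ, 0 < C ∧ ∀ r R : ℝ, 0 < r → r < R → R ≤ 1 →
    C * (r / R) ^ q ≤ μ.real (ball x r) / μ.real (ball x R)}

/-- With constant `c`, the capacity `cap_p(B_r, B_R)` of balls centred at `x` is bounded from
below by `(μ(B_s)/s^p) (log(R/r))^{1-p}` for `0 < 2r ≤ R ≤ R₀`, where `s = s(r,R)`. -/
def CapLowerBound {X : Type*} [PseudoMetricSpace X] [MeasurableSpace X]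
    (μ : Measure X) (p : ℝ) (x : X) (R₀ : ℝ) (s : ℝ → ℝ → ℝ) (c : ℝ) : Prop :=
  ∀ r R : ℝ, 0 < 2 * r → 2 * r ≤ R → R ≤ R₀ →
    ENNReal.ofReal
        (c * (μ.real (ball x (s r R)) / s r R ^ p * Real.log (R / r) ^ (1 - p))) ≤
      varCap μ p (ball x r) (ball x R)

/-- With constant `C`, the capacity `cap_p(B_r, B_R)` of balls centred at `x` is bounded from
above by `(μ(B_s)/s^p) (log(R/r))^{1-p}` for `0 < 2r ≤ R ≤ R₀`, where `s = s(r,R)`. -/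
def CapUpperBound {X : Type*} [PseudoMetricSpace X] [MeasurableSpace X]
    (μ : Measure X) (p : ℝ) (x : X) (R₀ : ℝ) (s : ℝ → ℝ → ℝ) (C : ℝ) : Prop :=
  ∀ r R : ℝ, 0 < 2 * r → 2 * r ≤ R → R ≤ R₀ →
    varCap μ p (ball x r) (ball x R) ≤
      ENNReal.ofReal
        (C * (μ.real (ball x (s r R)) / s r R ^ p * Real.log (R / r) ^ (1 - p)))

/-! Both estimates come from cutting the annulus between the radii r and R into about log(R/r)
dyadic pieces.

Upper bounds (`varCap_le_of_dyadic`, `varCap_ball_le`): let the test function drop by 1/N across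
each of N dyadic annuli. The gradients have disjoint supports, so the energy is at most N · N^(-p) ·
M, where M bounds μ(B_{2s})/s^p. Membership of p in the lower (upper) exponent set bounds M by a
multiple of μ(B_R)/R^p (of μ(B_r)/r^p).

Lower bounds (`SupportsPoincare.exists_le_varCap`): for admissible u, telescope the averages over
the balls B(x, 2^k r) out to a ball on which u = 0. This gives 1 ≤ C Σ_k ρ_k (⨍_{λB_k}
g^{p₀})^{1/p₀}. Plain Hölder to the exponent p would integrate g^p over overlapping balls and lose a
factor N^p. Since p₀ < p, `sum_mul_setLAverage_rpow_le` does better: split λB_k into disjoint shells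
A_j and apply Hölder on each. The factor (μ(A_j)/μ(λB_k))^{1/p₀-1/p} decays geometrically in k - j
by reverse doubling, so only N^(p-1) is lost. Reverse doubling holds because a Poincaré inequality
forces annuli to be nonempty.

The capacity is defined through minimal p-weak upper gradients. Upper bounds therefore need
`exists_isMinimalWeakUpperGradient`, whose core is the stability of weak upper gradients under
minima. Lower bounds need g to be cut off outside B_R and approximated by genuine upper gradients,
since the Poincaré inequality speaks only of those.

Converses: compare the assumed lower bound with the upper bound from a single annulus. The resulting
ratio bound for μ has exponent p up to a power of log(R/r), which any change of exponent absorbs. -/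

/-! ### Increments along curves, and subcurves. -/

/-- If the increments of `h` are controlled by the integrals of both `G₁` and `G₂`, then they are
controlled by the integral of the minimum. -/
theorem ofReal_abs_sub_le_lintegral_min {h : ℝ → ℝ} {a b : ℝ} (hab : a ≤ b) {G₁ G₂ : ℝ → ℝ≥0∞}
    (hm₁ : AEMeasurable G₁ (volume.restrict (Icc a b)))
    (hm₂ : AEMeasurable G₂ (volume.restrict (Icc a b)))
    (hf₁ : ∫⁻ t in Icc a b, G₁ t ≠ ∞) (hf₂ : ∫⁻ t in Icc a b, G₂ t ≠ ∞)
    (h₁ : ∀ s t, a ≤ s → s ≤ t → t ≤ b → ENNReal.ofReal |h s - h t| ≤ ∫⁻ v in Icc s t, G₁ v)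
    (h₂ : ∀ s t, a ≤ s → s ≤ t → t ≤ b → ENNReal.ofReal |h s - h t| ≤ ∫⁻ v in Icc s t, G₂ v) :
    ENNReal.ofReal |h a - h b| ≤ ∫⁻ t in Icc a b, min (G₁ t) (G₂ t) := by
  have key : ∀ G : ℝ → ℝ≥0∞, AEMeasurable G (volume.restrict (Icc a b)) →
      ∫⁻ t in Icc a b, G t ≠ ∞ →
      (∀ s t, a ≤ s → s ≤ t → t ≤ b → ENNReal.ofReal |h s - h t| ≤ ∫⁻ v in Icc s t, G v) →
      IntervalIntegrable (fun t => (G t).toReal) volume a b ∧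
      ∀ s ∈ uIcc a b, ∀ t ∈ uIcc a b,
        |h s - h t| ≤ |(∫ v in a..s, (G v).toReal) - ∫ v in a..t, (G v).toReal| := by
    intro G hm hf hG
    have hint : IntervalIntegrable (fun t => (G t).toReal) volume a b := by
      rw [intervalIntegrable_iff_integrableOn_Icc_of_le hab]
      exact integrable_toReal_of_lintegral_ne_top hm hf
    refine ⟨hint, ?_⟩
    have aux : ∀ s t, a ≤ s → s ≤ t → t ≤ b →
        |h s - h t| ≤ |(∫ v in a..s, (G v).toReal) - ∫ v in a..t, (G v).toReal| := by
      intro s t has hst htb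
      have hsub : Icc s t ⊆ Icc a b := Icc_subset_Icc has htb
      have hts : ∫⁻ v in Icc s t, G v ≠ ∞ := ne_top_of_le_ne_top hf (lintegral_mono_set hsub)
      have e : (∫ v in a..s, (G v).toReal) - ∫ v in a..t, (G v).toReal
          = - ∫ v in s..t, (G v).toReal := by
        rw [← intervalIntegral.integral_interval_sub_left (a := a) (b := t) (c := s)]
        · ring
        · exact hint.mono_set (by
            rw [uIcc_of_le hab, uIcc_of_le (has.trans hst)]; exact Icc_subset_Icc le_rfl htb)
        · exact hint.mono_set (by
            rw [uIcc_of_le hab, uIcc_of_le has]; exact Icc_subset_Icc le_rfl (hst.trans htb))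
      rw [e, abs_neg, intervalIntegral.integral_of_le hst, ← integral_Icc_eq_integral_Ioc,
        integral_toReal (hm.mono_measure (Measure.restrict_mono hsub le_rfl))
          (ae_lt_top' (hm.mono_measure (Measure.restrict_mono hsub le_rfl)) hts)]
      exact (ENNReal.ofReal_le_iff_le_toReal hts).1 (hG s t has hst htb) |>.trans (le_abs_self _)
    intro s hs t ht
    rw [uIcc_of_le hab] at hs ht
    rcases le_total s t with hst | hst
    · exact aux s t hs.1 hst ht.2
    · rw [abs_sub_comm, abs_sub_comm (∫ v in a..s, _)]
      exact aux t s ht.1 hst hs.2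
  obtain ⟨hi₁, hd₁⟩ := key G₁ hm₁ hf₁ h₁
  obtain ⟨hi₂, hd₂⟩ := key G₂ hm₂ hf₂ h₂
  -- `h` inherits absolute continuity from the primitive of `G₁`. Lebesgue differentiation then
  -- bounds |h'| a.e. by both densities, hence by their minimum, and integrating h' recovers the
  -- increment.
  have hac : AbsolutelyContinuousOnInterval h a b := by
    have hF := hi₁.absolutelyContinuousOnInterval_intervalIntegral (c := a) left_mem_uIcc
    rw [absolutelyContinuousOnInterval_iff] at hF ⊢
    intro ε hε
    obtain ⟨δ, hδ, H⟩ := hF ε hε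
    refine ⟨δ, hδ, fun E hE hlt => lt_of_le_of_lt (Finset.sum_le_sum fun i hi => ?_) (H E hE hlt)⟩
    have := hE.1 i hi
    simpa [Real.dist_eq] using hd₁ _ this.1 _ this.2
  have hderiv : ∀ G : ℝ → ℝ≥0∞, IntervalIntegrable (fun t => (G t).toReal) volume a b →
      (∀ s ∈ uIcc a b, ∀ t ∈ uIcc a b,
        |h s - h t| ≤ |(∫ v in a..s, (G v).toReal) - ∫ v in a..t, (G v).toReal|) →
      ∀ᵐ t, t ∈ Icc a b → |deriv h t| ≤ (G t).toReal := by
    intro G hi hd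
    have hab' : ∀ᵐ t : ℝ, t ≠ a ∧ t ≠ b := by
      have h1 : ∀ᵐ t : ℝ, t ≠ a := Measure.ae_ne volume a
      have h2 : ∀ᵐ t : ℝ, t ≠ b := Measure.ae_ne volume b
      filter_upwards [h1, h2] with t h1 h2 using ⟨h1, h2⟩
    filter_upwards [hac.ae_differentiableAt, hi.ae_hasDerivAt_integral, hab'] with t ht1 ht2 ht3 ht
    have htu : t ∈ uIcc a b := by rwa [uIcc_of_le hab]
    have hD1 := (ht1 htu).hasDerivAt.tendsto_slope.norm
    have hD2 := ((ht2 htu) a left_mem_uIcc).tendsto_slope.norm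
    have hle : ‖deriv h t‖ ≤ ‖(G t).toReal‖ := by
      refine le_of_tendsto_of_tendsto hD1 hD2 ?_
      have hnhds : Icc a b ∈ nhds t :=
        Icc_mem_nhds (lt_of_le_of_ne ht.1 ht3.1.symm) (lt_of_le_of_ne ht.2 ht3.2)
      filter_upwards [mem_nhdsWithin_of_mem_nhds hnhds] with s hs
      rw [slope_def_field, slope_def_field, norm_div, norm_div]
      have := hd s (by rwa [uIcc_of_le hab]) t htu
      exact div_le_div_of_nonneg_right this (norm_nonneg _)
    simpa [abs_of_nonneg] using hle
  have e1 := hderiv G₁ hi₁ hd₁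
  have e2 := hderiv G₂ hi₂ hd₂
  have hftc := hac.integral_deriv_eq_sub
  rw [abs_sub_comm, ← hftc, intervalIntegral.integral_of_le hab, ← integral_Icc_eq_integral_Ioc]
  calc ENNReal.ofReal |∫ t in Icc a b, deriv h t|
      ≤ ∫⁻ t in Icc a b, ENNReal.ofReal |deriv h t| := by
        have := enorm_integral_le_lintegral_enorm (μ := volume.restrict (Icc a b)) (deriv h)
        simpa [Real.enorm_eq_ofReal_abs] using this
    _ ≤ _ := by
        refine lintegral_mono_ae ?_
        rw [ae_restrict_iff' measurableSet_Icc]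
        filter_upwards [e1, e2] with t t1 t2 ht
        exact le_min ((ENNReal.ofReal_le_ofReal (t1 ht)).trans ENNReal.ofReal_toReal_le)
          ((ENNReal.ofReal_le_ofReal (t2 ht)).trans ENNReal.ofReal_toReal_le)

namespace ArcCurve

variable {X : Type*} [PseudoEMetricSpace X]

/-- The distance of two points is at most the variation between them, which unit speed equates with
the parameter difference. -/
theorem lipschitzOnWith (γ : ArcCurve X) : LipschitzOnWith 1 γ.toFun (Icc 0 γ.len) := by
  have aux : ∀ s ∈ Icc 0 γ.len, ∀ t ∈ Icc 0 γ.len, s ≤ t →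
      edist (γ.toFun s) (γ.toFun t) ≤ edist s t := by
    intro s hs t ht hst
    have h := γ.unitSpeed hs ht
    have h2 := eVariationOn.edist_le γ.toFun (s := Icc 0 γ.len ∩ Icc s t)
      ⟨hs, le_rfl, hst⟩ ⟨ht, hst, le_rfl⟩
    rw [h] at h2
    rw [edist_comm s t, edist_dist, Real.dist_eq, abs_of_nonneg (sub_nonneg.2 hst)]
    simpa using h2
  intro s hs t ht
  rw [ENNReal.coe_one, one_mul]
  rcases le_total s t with hst | hst
  · exact aux s hs t ht hst
  · rw [edist_comm, edist_comm s]
    exact aux t ht s hs hst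

theorem continuousOn (γ : ArcCurve X) : ContinuousOn γ.toFun (Icc 0 γ.len) :=
  γ.lipschitzOnWith.continuousOn

/-- The part of `γ` between the parameters `a` and `b`. -/
def sub (γ : ArcCurve X) (a b : ℝ) (ha : 0 ≤ a) (hab : a < b) (hb : b ≤ γ.len) : ArcCurve X where
  len := b - a
  len_pos := sub_pos.2 hab
  toFun t := γ.toFun (a + t)
  unitSpeed := by
    intro s hs t ht
    have h := γ.unitSpeed (x := a + s) ⟨by linarith [hs.1], by linarith [hs.2]⟩ (y := a + t)
      ⟨by linarith [ht.1], by linarith [ht.2]⟩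
    have e := eVariationOn.comp_eq_of_monotoneOn γ.toFun (t := Icc 0 (b - a) ∩ Icc s t)
      (fun t => a + t) (fun u _ v _ huv => by simpa using huv)
    have e2 : (fun t => a + t) '' (Icc 0 (b - a) ∩ Icc s t)
        = Icc 0 γ.len ∩ Icc (a + s) (a + t) := by
      ext v
      constructor
      · rintro ⟨w, ⟨⟨h1, h2⟩, h3, h4⟩, rfl⟩
        exact ⟨⟨by linarith, by linarith⟩, by linarith, by linarith⟩
      · rintro ⟨⟨h1, h2⟩, h3, h4⟩
        exact ⟨v - a, ⟨⟨by linarith [hs.1], by linarith [ht.2]⟩, by linarith, by linarith⟩,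
          by ring⟩
    rw [e2, h] at e
    rw [show (fun t => γ.toFun (a + t)) = γ.toFun ∘ (fun t => a + t) from rfl, e]
    congr 1; ring

theorem lineIntegral_sub (γ : ArcCurve X) {a b : ℝ} (ha : 0 ≤ a) (hab : a < b) (hb : b ≤ γ.len)
    (g : X → ℝ≥0∞) :
    (γ.sub a b ha hab hb).lineIntegral g = ∫⁻ t in Icc a b, g (γ.toFun t) := by
  have h := (measurePreserving_add_left (volume : Measure ℝ) a).setLIntegral_comp_preimage_emb
    (measurableEmbedding_addLeft a) (fun t => g (γ.toFun t)) (Icc a b)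
  have : (fun t => a + t) ⁻¹' Icc a b = Icc 0 (b - a) := by
    ext t; simp only [mem_preimage, mem_Icc]; constructor <;> rintro ⟨h1, h2⟩ <;>
      constructor <;> linarith
  rw [this] at h
  exact h

theorem lineIntegral_sub_le (γ : ArcCurve X) {a b : ℝ} (ha : 0 ≤ a) (hab : a < b)
    (hb : b ≤ γ.len) (g : X → ℝ≥0∞) :
    (γ.sub a b ha hab hb).lineIntegral g ≤ γ.lineIntegral g := by
  rw [lineIntegral_sub]
  exact lintegral_mono_set (Icc_subset_Icc ha hb)

theorem aemeasurable_comp [MeasurableSpace X] [BorelSpace X] (γ : ArcCurve X) {g : X → ℝ≥0∞}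
    (hg : Measurable g) :
    AEMeasurable (fun t => g (γ.toFun t)) (volume.restrict (Icc 0 γ.len)) :=
  hg.comp_aemeasurable (γ.continuousOn.aemeasurable measurableSet_Icc)

end ArcCurve

/-- The upper gradient inequality on all subcurves controls all increments along the curve. -/
theorem ofReal_abs_sub_le_setLIntegral {X : Type*} [PseudoEMetricSpace X] {f : X → ℝ}
    {g : X → ℝ≥0∞} {γ : ArcCurve X}
    (h : ∀ a b (ha : 0 ≤ a) (hab : a < b) (hb : b ≤ γ.len),
      UpperGradientIneq f g (γ.sub a b ha hab hb))
    {s t : ℝ} (hs : 0 ≤ s) (hst : s ≤ t) (ht : t ≤ γ.len) :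
    ENNReal.ofReal |f (γ.toFun s) - f (γ.toFun t)| ≤ ∫⁻ v in Icc s t, g (γ.toFun v) := by
  rcases hst.eq_or_lt with rfl | hlt
  · simp
  · have := h s t hs hlt ht
    rw [UpperGradientIneq, ArcCurve.lineIntegral_sub] at this
    simpa [ArcCurve.sub] using this

/-! ### Exceptional curve families and the minimal weak upper gradient. -/

section Modulus

variable {X : Type*} [PseudoEMetricSpace X] [MeasurableSpace X] {μ : Measure X} {p : ℝ}

theorem ZeroModulus.mono {Γ Γ' : Set (ArcCurve X)} (h : ZeroModulus μ p Γ') (hs : Γ ⊆ Γ') :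
    ZeroModulus μ p Γ := by
  obtain ⟨ρ, hm, hf, hρ⟩ := h
  exact ⟨ρ, hm, hf, fun γ hγ => hρ γ (hs hγ)⟩

/-- Rescale the witnesses by δ_n^{1/p} so that their energies are summable and take the supremum:
its p-th power is at most the sum of the p-th powers, while it still dominates each positive
multiple. -/
theorem ZeroModulus.iUnion (hp : 0 < p) {Γ : ℕ → Set (ArcCurve X)}
    (h : ∀ n, ZeroModulus μ p (Γ n)) : ZeroModulus μ p (⋃ n, Γ n) := by
  choose ρ hm hf hρ using h
  obtain ⟨δ, hδ, hsum⟩ := ENNReal.exists_pos_tsum_mul_lt_of_countable one_ne_zero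
    (fun n => ∫⁻ y, ρ n y ^ p ∂μ) (fun n => (hf n).ne)
  have hδ' : ∀ n, ((δ n : ℝ≥0∞) ^ p⁻¹) ≠ 0 := fun n => by
    simp [ENNReal.rpow_eq_zero_iff, (hδ n).ne']
  refine ⟨fun y => ⨆ n, (δ n : ℝ≥0∞) ^ p⁻¹ * ρ n y, Measurable.iSup fun n => (hm n).const_mul _,
    ?_, ?_⟩
  · refine lt_of_le_of_lt ?_ (hsum.trans ENNReal.one_lt_top)
    calc ∫⁻ y, (⨆ n, (δ n : ℝ≥0∞) ^ p⁻¹ * ρ n y) ^ p ∂μ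
        ≤ ∫⁻ y, ∑' n, δ n * ρ n y ^ p ∂μ := by
          refine lintegral_mono fun y => ?_
          rw [← ENNReal.le_rpow_inv_iff hp]
          refine iSup_le fun n => ?_
          rw [ENNReal.le_rpow_inv_iff hp, ENNReal.mul_rpow_of_nonneg _ _ hp.le,
            ENNReal.rpow_inv_rpow hp.ne']
          exact ENNReal.le_tsum (f := fun n => (δ n : ℝ≥0∞) * ρ n y ^ p) n
      _ = ∑' n, (∫⁻ y, ρ n y ^ p ∂μ) * δ n := by
          rw [lintegral_tsum fun n => (((hm n).pow_const p).const_mul _).aemeasurable]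
          refine tsum_congr fun n => ?_
          rw [lintegral_const_mul _ ((hm n).pow_const p), mul_comm]
  · intro γ hγ
    obtain ⟨n, hn⟩ := mem_iUnion.1 hγ
    rw [eq_top_iff]
    calc ∞ = (δ n : ℝ≥0∞) ^ p⁻¹ * γ.lineIntegral (ρ n) := by
          rw [hρ n γ hn, ENNReal.mul_top (hδ' n)]
      _ ≤ ∫⁻ t in Icc 0 γ.len, (δ n : ℝ≥0∞) ^ p⁻¹ * ρ n (γ.toFun t) :=
          lintegral_const_mul_le _ _
      _ ≤ _ := lintegral_mono fun t => le_iSup (fun n => (δ n : ℝ≥0∞) ^ p⁻¹ * ρ n (γ.toFun t)) n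

theorem ZeroModulus.union (hp : 0 < p) {Γ Γ' : Set (ArcCurve X)}
    (h : ZeroModulus μ p Γ) (h' : ZeroModulus μ p Γ') : ZeroModulus μ p (Γ ∪ Γ') := by
  refine (ZeroModulus.iUnion hp (Γ := fun n => if n = 0 then Γ else Γ') fun n => ?_).mono ?_
  · split_ifs <;> assumption
  · exact union_subset (subset_iUnion_of_subset 0 (by simp)) (subset_iUnion_of_subset 1 (by simp))

/-- Almost every curve has no subcurve in a family of zero modulus. -/
theorem ZeroModulus.subcurves {Γ : Set (ArcCurve X)} (h : ZeroModulus μ p Γ) :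
    ZeroModulus μ p {γ | ∃ a b, ∃ (ha : 0 ≤ a) (hab : a < b) (hb : b ≤ γ.len),
      γ.sub a b ha hab hb ∈ Γ} := by
  obtain ⟨ρ, hm, hf, hρ⟩ := h
  refine ⟨ρ, hm, hf, ?_⟩
  rintro γ ⟨a, b, ha, hab, hb, hγ⟩
  exact top_unique ((hρ _ hγ).ge.trans (γ.lineIntegral_sub_le ha hab hb ρ))

theorem zeroModulus_lineIntegral_eq_top {g : X → ℝ≥0∞} (hg : Measurable g)
    (hf : ∫⁻ y, g y ^ p ∂μ ≠ ∞) : ZeroModulus μ p {γ | γ.lineIntegral g = ∞} :=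
  ⟨g, hg, hf.lt_top, fun _ h => h⟩

theorem IsUpperGradient.isWeakUpperGradient (hp : 0 < p) {f : X → ℝ} {g : X → ℝ≥0∞}
    (h : IsUpperGradient f g) : IsWeakUpperGradient μ p f g :=
  ⟨h.1.aemeasurable, fun _ => 0, measurable_const, by simp [hp],
    fun γ hγ => (hγ (h.2 γ)).elim⟩

variable [BorelSpace X]

/-- Almost every curve spends zero length in a set of measure zero. -/
theorem zeroModulus_of_null (hp : 0 < p) {N : Set X} (hN : MeasurableSet N) (h0 : μ N = 0) :
    ZeroModulus μ p {γ | ¬ ∀ᵐ t ∂volume.restrict (Icc 0 γ.len), γ.toFun t ∉ N} := by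
  -- The function ∞ · 1_N has zero energy, and its line integral is finite only along curves that
  -- spend no time in N.
  refine ⟨N.indicator fun _ => ∞, measurable_const.indicator hN, ?_, ?_⟩
  · have : ∀ y, (N.indicator (fun _ => (∞ : ℝ≥0∞)) y) ^ p = N.indicator (fun _ => ∞) y := by
      intro y
      by_cases hy : y ∈ N <;> simp [hy, hp]
    simp_rw [this, lintegral_indicator hN]
    simp [h0]
  · intro γ hγ
    by_contra hne
    apply hγ
    have := ae_lt_top' (γ.aemeasurable_comp (measurable_const.indicator hN)) hne
    filter_upwards [this] with t ht hmem
    simp [hmem] at ht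

variable {f : X → ℝ}

/-- Almost every curve spends no time where the two functions differ. This permits passing to Borel
representatives, whose compositions with curves are measurable. -/
theorem IsWeakUpperGradient.congr_ae (hp : 0 < p) {g g' : X → ℝ≥0∞}
    (h : IsWeakUpperGradient μ p f g) (he : g =ᵐ[μ] g') : IsWeakUpperGradient μ p f g' := by
  refine ⟨h.1.congr he, ?_⟩
  obtain ⟨N, hsub, hN, h0⟩ := exists_measurable_superset_of_null (ae_iff.1 he)
  refine (h.2.union hp (zeroModulus_of_null hp hN h0)).mono fun γ hγ => ?_
  by_contra hcon
  rw [mem_union, not_or] at hcon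
  simp only [mem_ofPred_eq, not_not] at hcon
  apply hγ
  refine hcon.1.trans (lintegral_mono_ae ?_)
  filter_upwards [hcon.2] with t ht
  have : g (γ.toFun t) = g' (γ.toFun t) := by
    by_contra hne; exact ht (hsub hne)
  exact this.le

theorem IsWeakUpperGradient.exists_measurable (hp : 0 < p) {g : X → ℝ≥0∞}
    (h : IsWeakUpperGradient μ p f g) :
    ∃ g', Measurable g' ∧ g =ᵐ[μ] g' ∧ IsWeakUpperGradient μ p f g' :=
  ⟨h.1.mk g, h.1.measurable_mk, h.1.ae_eq_mk, h.congr_ae hp h.1.ae_eq_mk⟩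

/-- Along almost every curve both line integrals are finite and both inequalities hold on every
subcurve, so the one-dimensional statement about minima applies. -/
theorem IsWeakUpperGradient.min (hp : 0 < p) {g₁ g₂ : X → ℝ≥0∞}
    (h₁ : IsWeakUpperGradient μ p f g₁) (h₂ : IsWeakUpperGradient μ p f g₂)
    (hf₁ : ∫⁻ y, g₁ y ^ p ∂μ ≠ ∞) (hf₂ : ∫⁻ y, g₂ y ^ p ∂μ ≠ ∞) :
    IsWeakUpperGradient μ p f fun y => min (g₁ y) (g₂ y) := by
  obtain ⟨k₁, hm₁, e₁, hk₁⟩ := h₁.exists_measurable hp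
  obtain ⟨k₂, hm₂, e₂, hk₂⟩ := h₂.exists_measurable hp
  have hF₁ : ∫⁻ y, k₁ y ^ p ∂μ ≠ ∞ := by
    rwa [← lintegral_congr_ae (e₁.mono fun y hy => congrArg (· ^ p) hy)]
  have hF₂ : ∫⁻ y, k₂ y ^ p ∂μ ≠ ∞ := by
    rwa [← lintegral_congr_ae (e₂.mono fun y hy => congrArg (· ^ p) hy)]
  refine IsWeakUpperGradient.congr_ae hp (g := fun y => Min.min (k₁ y) (k₂ y)) ?_ ?_
  swap
  · filter_upwards [e₁, e₂] with y h1 h2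
    rw [h1, h2]
  refine ⟨(hm₁.min hm₂).aemeasurable, ?_⟩
  refine ((hk₁.2.subcurves.union hp hk₂.2.subcurves).union hp
    ((zeroModulus_lineIntegral_eq_top hm₁ hF₁).union hp
      (zeroModulus_lineIntegral_eq_top hm₂ hF₂))).mono fun γ hγ => ?_
  by_contra hcon
  simp only [mem_union, not_or, mem_ofPred_eq, not_exists, not_not] at hcon
  obtain ⟨⟨c1, c2⟩, c3, c4⟩ := hcon
  exact hγ (ofReal_abs_sub_le_lintegral_min (h := fun t => f (γ.toFun t)) γ.len_pos.le
    (γ.aemeasurable_comp hm₁) (γ.aemeasurable_comp hm₂) c3 c4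
    (fun s t hs hst ht => ofReal_abs_sub_le_setLIntegral c1 hs hst ht)
    (fun s t hs hst ht => ofReal_abs_sub_le_setLIntegral c2 hs hst ht))

/-- Monotone convergence along decreasing sequences needs a finite first integral; the energy bound
on `g 0` supplies it on almost every curve. -/
theorem IsWeakUpperGradient.iInf_of_antitone (hp : 0 < p) {g : ℕ → X → ℝ≥0∞}
    (h : ∀ n, IsWeakUpperGradient μ p f (g n)) (hanti : ∀ y, Antitone fun n => g n y)
    (hf : ∫⁻ y, g 0 y ^ p ∂μ ≠ ∞) :
    IsWeakUpperGradient μ p f fun y => ⨅ n, g n y := by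
  choose k hm e hk using fun n => (h n).exists_measurable hp
  have hF : ∫⁻ y, k 0 y ^ p ∂μ ≠ ∞ := by
    rwa [← lintegral_congr_ae ((e 0).mono fun y hy => congrArg (· ^ p) hy)]
  obtain ⟨N, hsub, hN, h0⟩ := exists_measurable_superset_of_null
    (ae_iff.1 (ae_all_iff.2 e : ∀ᵐ y ∂μ, ∀ n, g n y = k n y))
  have e' : ∀ y ∉ N, ∀ n, g n y = k n y := by
    intro y hy
    by_contra hne; exact hy (hsub hne)
  refine IsWeakUpperGradient.congr_ae hp (g := fun y => ⨅ n, k n y) ?_ ?_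
  swap
  · filter_upwards [ae_all_iff.2 e] with y hy
    exact iInf_congr fun n => (hy n).symm
  refine ⟨(Measurable.iInf hm).aemeasurable, ?_⟩
  refine ((ZeroModulus.iUnion hp fun n => (hk n).2).union hp
    ((zeroModulus_lineIntegral_eq_top (hm 0) hF).union hp
      (zeroModulus_of_null hp hN h0))).mono fun γ hγ => ?_
  by_contra hcon
  simp only [mem_union, not_or, mem_iUnion, mem_ofPred_eq, not_exists, not_not] at hcon
  obtain ⟨c1, c2, c3⟩ := hcon
  apply hγ
  have := lintegral_iInf' (μ := volume.restrict (Icc 0 γ.len))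
    (f := fun n t => k n (γ.toFun t)) (fun n => γ.aemeasurable_comp (hm n)) ?_ c2
  · rw [UpperGradientIneq, ArcCurve.lineIntegral, this]
    exact le_iInf fun n => c1 n
  · filter_upwards [c3] with t ht
    simp_rw [← e' _ ht]
    exact hanti _

/-- Running minima of a minimizing sequence decrease to a weak upper gradient w of least energy. For
a competitor h, min(w, h) cannot have smaller energy, so it equals w a.e. -/
theorem exists_isMinimalWeakUpperGradient (hp : 0 < p) {g₀ : X → ℝ≥0∞}
    (h₀ : IsWeakUpperGradient μ p f g₀) (hf₀ : ∫⁻ y, g₀ y ^ p ∂μ < ∞) :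
    ∃ g, IsMinimalWeakUpperGradient μ p f g := by
  let S : Set ℝ≥0∞ := (fun g : X → ℝ≥0∞ => ∫⁻ y, g y ^ p ∂μ) ''
    {g | IsWeakUpperGradient μ p f g ∧ ∫⁻ y, g y ^ p ∂μ < ∞}
  have hS : S.Nonempty := ⟨_, g₀, ⟨h₀, hf₀⟩, rfl⟩
  obtain ⟨u, -, hlim, hu⟩ := exists_seq_tendsto_sInf hS (OrderBot.bddBelow S)
  choose k hk hku using hu
  let G : ℕ → X → ℝ≥0∞ := fun n => n.rec (k 0) fun n F y => Min.min (F y) (k (n + 1) y)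
  have hGs : ∀ n y, G (n + 1) y = Min.min (G n y) (k (n + 1) y) := fun n y => rfl
  have hGk : ∀ n y, G n y ≤ k n y := by
    intro n y
    cases n with
    | zero => exact le_rfl
    | succ n => rw [hGs]; exact min_le_right _ _
  have hGf : ∀ n, ∫⁻ y, G n y ^ p ∂μ < ∞ := fun n =>
    (lintegral_mono fun y => ENNReal.rpow_le_rpow (hGk n y) hp.le).trans_lt (hk n).2
  have hGw : ∀ n, IsWeakUpperGradient μ p f (G n) := by
    intro n
    induction n with
    | zero => exact (hk 0).1
    | succ n ih => exact ih.min hp (hk (n + 1)).1 (hGf n).ne (hk (n + 1)).2.ne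
  have hw : IsWeakUpperGradient μ p f fun y => ⨅ n, G n y :=
    IsWeakUpperGradient.iInf_of_antitone hp hGw
      (fun y => antitone_nat_of_succ_le fun n => by rw [hGs]; exact min_le_left _ _) (hGf 0).ne
  have hle : ∫⁻ y, (⨅ n, G n y) ^ p ∂μ ≤ sInf S := by
    refine ge_of_tendsto' hlim fun n => ?_
    rw [← hku n]
    exact lintegral_mono fun y => ENNReal.rpow_le_rpow ((iInf_le _ n).trans (hGk n y)) hp.le
  have hfin : ∫⁻ y, (⨅ n, G n y) ^ p ∂μ < ∞ :=
    (lintegral_mono fun y => ENNReal.rpow_le_rpow (iInf_le _ 0) hp.le).trans_lt (hGf 0)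
  refine ⟨_, hw, hfin, fun h hh hhf => ?_⟩
  have hmin := hw.min hp hh hfin.ne hhf.ne
  have hminle : ∫⁻ y, (Min.min (⨅ n, G n y) (h y)) ^ p ∂μ ≤ ∫⁻ y, (⨅ n, G n y) ^ p ∂μ :=
    lintegral_mono fun y => ENNReal.rpow_le_rpow (min_le_left _ _) hp.le
  have hge : sInf S ≤ ∫⁻ y, (Min.min (⨅ n, G n y) (h y)) ^ p ∂μ :=
    sInf_le ⟨_, ⟨hmin, hminle.trans_lt hfin⟩, rfl⟩
  have hae := ae_eq_of_ae_le_of_lintegral_le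
    (ae_of_all μ fun y => ENNReal.rpow_le_rpow (min_le_left (⨅ n, G n y) (h y)) hp.le)
    (hminle.trans_lt hfin).ne (hw.1.pow_const p) (hle.trans hge)
  filter_upwards [hae] with y hy
  have := ENNReal.rpow_left_injective hp.ne' hy
  exact min_eq_left_iff.1 this

/-- The capacity is at most the energy of any upper gradient of an admissible function. -/
theorem varCap_le_lintegral (hp : 0 < p) {E Ω : Set X} (hu : CapAdmissible μ p E Ω f)
    {g : X → ℝ≥0∞} (hg : IsUpperGradient f g) (hgf : ∫⁻ y, g y ^ p ∂μ < ∞) :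
    varCap μ p E Ω ≤ ∫⁻ y, g y ^ p ∂μ := by
  -- Existence is essential: without a minimal weak upper gradient the inner infimum in `varCap`
  -- would be empty, hence `∞`.
  obtain ⟨k, hk⟩ := exists_isMinimalWeakUpperGradient hp (μ := μ)
    (hg.isWeakUpperGradient hp) hgf
  refine (iInf₂_le f hu).trans ((iInf₂_le k hk).trans ?_)
  refine (setLIntegral_le_lintegral _ _).trans (lintegral_mono_ae ?_)
  filter_upwards [hk.2.2 g (hg.isWeakUpperGradient hp) hgf] with y hy
  exact ENNReal.rpow_le_rpow hy hp.le

end Modulus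

/-! ### Radial test functions and their energy. -/

/-- A `1`-Lipschitz function spends in `(a, b)` at least the time its truncation needs to move
between its end values. -/
theorem ofReal_abs_clamp_sub_clamp_le_volume {f : ℝ → ℝ} {L a b : ℝ} (hL : 0 ≤ L) (hab : a ≤ b)
    (hf : LipschitzOnWith 1 f (Icc 0 L)) :
    ENNReal.ofReal |max a (min b (f 0)) - max a (min b (f L))| ≤
      volume (f ⁻¹' Ioo a b ∩ Icc 0 L) := by
  set A := min (max a (min b (f 0))) (max a (min b (f L))) with hA
  set B := max (max a (min b (f 0))) (max a (min b (f L))) with hB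
  -- Values strictly between the clamped end values lie in (a, b) and are attained, by the
  -- intermediate value theorem; a 1-Lipschitz map does not increase length.
  have hsub : Ioo A B ⊆ f '' (f ⁻¹' Ioo a b ∩ Icc 0 L) := by
    intro v hv
    have h1 : v ∈ Ioo a b := by
      constructor <;> grind
    have h2 : v ∈ uIcc (f 0) (f L) := by
      rw [mem_uIcc]; grind
    obtain ⟨t, ht, rfl⟩ := intermediate_value_uIcc
      (by rw [uIcc_of_le hL]; exact hf.continuousOn) h2
    rw [uIcc_of_le hL] at ht
    exact ⟨t, ⟨h1, ht⟩, rfl⟩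
  calc ENNReal.ofReal |max a (min b (f 0)) - max a (min b (f L))|
      = volume (Ioo A B) := by
        rw [Real.volume_Ioo, hA, hB, max_sub_min_eq_abs, abs_sub_comm]
    _ ≤ volume (f '' (f ⁻¹' Ioo a b ∩ Icc 0 L)) := measure_mono hsub
    _ ≤ volume (f ⁻¹' Ioo a b ∩ Icc 0 L) := by
        have := (hf.mono inter_subset_right).hausdorffMeasure_image_le (d := 1)
          (s := f ⁻¹' Ioo a b ∩ Icc 0 L) zero_le_one
        simpa [hausdorffMeasure_real] using this

section UpperGradient

variable {X : Type*} [PseudoEMetricSpace X] [MeasurableSpace X]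

theorem IsUpperGradient.const_mul {f : X → ℝ} {g : X → ℝ≥0∞} (h : IsUpperGradient f g) {c : ℝ}
    (hc : 0 ≤ c) : IsUpperGradient (fun y => c * f y) fun y => ENNReal.ofReal c * g y := by
  refine ⟨h.1.const_mul _, fun γ => ?_⟩
  refine le_trans ?_ (lintegral_const_mul_le _ _)
  rw [← mul_sub, abs_mul, abs_of_nonneg hc, ENNReal.ofReal_mul hc]
  gcongr
  exact h.2 γ

theorem IsUpperGradient.sum [BorelSpace X] {ι : Type*} (s : Finset ι) {f : ι → X → ℝ}
    {g : ι → X → ℝ≥0∞} (h : ∀ i ∈ s, IsUpperGradient (f i) (g i)) :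
    IsUpperGradient (fun y => ∑ i ∈ s, f i y) fun y => ∑ i ∈ s, g i y := by
  refine ⟨Finset.measurable_fun_sum s fun i hi => (h i hi).1, fun γ => ?_⟩
  rw [UpperGradientIneq, ArcCurve.lineIntegral,
    lintegral_finsetSum' _ fun i hi => γ.aemeasurable_comp (h i hi).1, ← Finset.sum_sub_distrib]
  refine (ENNReal.ofReal_le_ofReal (Finset.abs_sum_le_sum_abs _ _)).trans ?_
  rw [ENNReal.ofReal_sum_of_nonneg fun i _ => abs_nonneg _]
  exact Finset.sum_le_sum fun i hi => (h i hi).2 γ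

end UpperGradient

section Cutoff

variable {X : Type*} [PseudoMetricSpace X]

/-- The radial cutoff function, equal to `1` on `B(x, a)` and to `0` outside `B(x, 2a)`. -/
noncomputable def radialCutoff (x : X) (a : ℝ) (y : X) : ℝ :=
  2 - max a (min (2 * a) (dist y x)) / a

theorem radialCutoff_eq_one {x y : X} {a : ℝ} (ha : 0 < a) (h : dist y x ≤ a) :
    radialCutoff x a y = 1 := by
  have : max a (min (2 * a) (dist y x)) = a := max_eq_left ((min_le_right _ _).trans h)
  rw [radialCutoff, this, div_self ha.ne']; norm_num

theorem radialCutoff_eq_zero {x y : X} {a : ℝ} (ha : 0 < a) (h : 2 * a ≤ dist y x) :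
    radialCutoff x a y = 0 := by
  have : max a (min (2 * a) (dist y x)) = 2 * a := by
    rw [min_eq_left h, max_eq_right (by linarith)]
  rw [radialCutoff, this]; field_simp; norm_num

theorem radialCutoff_nonneg {x y : X} {a : ℝ} (ha : 0 < a) : 0 ≤ radialCutoff x a y := by
  rw [radialCutoff, sub_nonneg, div_le_iff₀ ha]
  exact max_le (by linarith) (min_le_left _ _)

theorem radialCutoff_le_one {x y : X} {a : ℝ} (ha : 0 < a) : radialCutoff x a y ≤ 1 := by
  have : 1 ≤ max a (min (2 * a) (dist y x)) / a := by
    rw [le_div_iff₀ ha, one_mul]; exact le_max_left _ _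
  rw [radialCutoff]; linarith

theorem continuous_radialCutoff (x : X) (a : ℝ) : Continuous (radialCutoff x a) := by
  unfold radialCutoff; fun_prop

/-- The open annulus `{y | a < d(x, y) < 2 a}`. -/
def openAnnulus (x : X) (a : ℝ) : Set X := (fun y => dist y x) ⁻¹' Ioo a (2 * a)

variable [MeasurableSpace X] [BorelSpace X]

theorem measurableSet_openAnnulus (x : X) (a : ℝ) : MeasurableSet (openAnnulus x a) :=
  (isOpen_Ioo.preimage (by fun_prop)).measurableSet

/-- The time a curve spends in the annulus is at least the change of the clamped distance to x. With
gradients carried by open annuli, different dyadic scales have disjoint supports. -/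
theorem isUpperGradient_radialCutoff (x : X) {a : ℝ} (ha : 0 < a) :
    IsUpperGradient (radialCutoff x a)
      ((openAnnulus x a).indicator fun _ => ENNReal.ofReal a⁻¹) := by
  refine ⟨measurable_const.indicator (measurableSet_openAnnulus x a), fun γ => ?_⟩
  have hLip : LipschitzOnWith 1 (fun t => dist (γ.toFun t) x) (Icc 0 γ.len) := by
    have := (LipschitzWith.dist_left x).comp_lipschitzOnWith γ.lipschitzOnWith
    rwa [one_mul] at this
  have h := ofReal_abs_clamp_sub_clamp_le_volume γ.len_pos.le (show a ≤ 2 * a by linarith) hLip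
  have hnull : NullMeasurableSet (γ.toFun ⁻¹' openAnnulus x a)
      (volume.restrict (Icc 0 γ.len)) :=
    (γ.continuousOn.aemeasurable measurableSet_Icc).nullMeasurableSet_preimage
      (measurableSet_openAnnulus x a)
  have e : γ.lineIntegral ((openAnnulus x a).indicator fun _ => ENNReal.ofReal a⁻¹) =
      ENNReal.ofReal a⁻¹ * volume (γ.toFun ⁻¹' openAnnulus x a ∩ Icc 0 γ.len) := by
    have := lintegral_indicator_const₀ hnull (ENNReal.ofReal a⁻¹)
    rw [Measure.restrict_apply' measurableSet_Icc] at this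
    exact this
  rw [UpperGradientIneq, e]
  have e2 : |radialCutoff x a (γ.toFun 0) - radialCutoff x a (γ.toFun γ.len)| =
      a⁻¹ * |max a (min (2 * a) (dist (γ.toFun 0) x)) -
        max a (min (2 * a) (dist (γ.toFun γ.len) x))| := by
    rw [abs_sub_comm]
    conv_rhs => rw [← abs_of_pos (inv_pos.2 ha), ← abs_mul]
    congr 1; simp only [radialCutoff]; ring
  rw [e2, ENNReal.ofReal_mul (inv_pos.2 ha).le]
  gcongr
  exact h

variable {μ : Measure X} {p : ℝ}

/-- Upper capacity estimate obtained from a test function with equal drops over `N` consecutive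
dyadic annuli. -/
theorem varCap_le_of_dyadic (hp : 0 < p) (x : X) (hfin : ∀ s, μ (ball x s) ≠ ∞) {r R M : ℝ}
    (hr : 0 < r) {N : ℕ} (hN : 0 < N) (hR : 2 ^ N * r ≤ R)
    (hM : ∀ k < N, μ.real (ball x (2 ^ (k + 1) * r)) / (2 ^ k * r) ^ p ≤ M) :
    varCap μ p (ball x r) (ball x R) ≤ ENNReal.ofReal ((N : ℝ) ^ (1 - p) * M) := by
  have hNr : (0 : ℝ) < N := by exact_mod_cast hN
  have hk : ∀ k : ℕ, 0 < 2 ^ k * r := fun k => by positivity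
  set u : X → ℝ := fun y => (N : ℝ)⁻¹ * ∑ k ∈ Finset.range N, radialCutoff x (2 ^ k * r) y with hu
  set h : X → ℝ≥0∞ := fun y => ENNReal.ofReal (N : ℝ)⁻¹ * ∑ k ∈ Finset.range N,
    (openAnnulus x (2 ^ k * r)).indicator (fun _ => ENNReal.ofReal (2 ^ k * r)⁻¹) y with hh
  have hug : IsUpperGradient u h :=
    (IsUpperGradient.sum _ fun k _ => isUpperGradient_radialCutoff x (hk k)).const_mul
      (inv_nonneg.2 hNr.le)
  have hsub : ∀ k, openAnnulus x (2 ^ k * r) ⊆ ball x (2 ^ (k + 1) * r) := by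
    intro k y hy
    have := hy.2
    rw [mem_ball]
    calc dist y x < 2 * (2 ^ k * r) := this
      _ = _ := by ring
  have hdisj : ∀ j k : ℕ, j < k → ∀ y, y ∈ openAnnulus x (2 ^ j * r) →
      y ∉ openAnnulus x (2 ^ k * r) := by
    intro j k hjk y hj hk'
    have h1 : dist y x < 2 * (2 ^ j * r) := hj.2
    have h2 : 2 ^ k * r < dist y x := hk'.1
    have h3 : (2 : ℝ) ^ (j + 1) ≤ 2 ^ k := pow_le_pow_right₀ (by norm_num) hjk
    have h4 := mul_le_mul_of_nonneg_right h3 hr.le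
    rw [pow_succ] at h4
    linarith
  -- At most one summand is nonzero at each point, so the power passes inside the sum.
  have hpow : ∀ y, h y ^ p = ∑ k ∈ Finset.range N, (openAnnulus x (2 ^ k * r)).indicator
      (fun _ => (ENNReal.ofReal (N : ℝ)⁻¹ * ENNReal.ofReal (2 ^ k * r)⁻¹) ^ p) y := by
    intro y
    by_cases hy : ∃ k ∈ Finset.range N, y ∈ openAnnulus x (2 ^ k * r)
    · obtain ⟨k, hkN, hyk⟩ := hy
      have hne : ∀ j ∈ Finset.range N, j ≠ k → y ∉ openAnnulus x (2 ^ j * r) := by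
        intro j _ hjk hyj
        rcases lt_or_gt_of_ne hjk with hlt | hlt
        · exact hdisj j k hlt y hyj hyk
        · exact hdisj k j hlt y hyk hyj
      rw [hh, Finset.sum_eq_single_of_mem k hkN fun j hj hjk => by
        rw [indicator_of_notMem (hne j hj hjk)]]
      dsimp only
      rw [Finset.sum_eq_single_of_mem k hkN fun j hj hjk => by
        rw [indicator_of_notMem (hne j hj hjk)], indicator_of_mem hyk, indicator_of_mem hyk]
    · push Not at hy
      rw [hh, Finset.sum_eq_zero fun j hj => by rw [indicator_of_notMem (hy j hj)]]
      dsimp only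
      rw [Finset.sum_eq_zero fun j hj => by rw [indicator_of_notMem (hy j hj)]]
      simp [hp]
  have hint : ∫⁻ y, h y ^ p ∂μ ≤ ENNReal.ofReal ((N : ℝ) ^ (1 - p) * M) := by
    simp_rw [hpow]
    rw [lintegral_finsetSum _ fun k _ =>
      measurable_const.indicator (measurableSet_openAnnulus x _)]
    calc ∑ k ∈ Finset.range N, ∫⁻ y, (openAnnulus x (2 ^ k * r)).indicator
          (fun _ => (ENNReal.ofReal (N : ℝ)⁻¹ * ENNReal.ofReal (2 ^ k * r)⁻¹) ^ p) y ∂μ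
        -- On the k-th annulus the gradient is 1/(N 2^k r), so `hM` bounds its energy there by
        -- N^(-p) M.
        ≤ ∑ k ∈ Finset.range N, ENNReal.ofReal ((N : ℝ) ^ (-p) * M) := by
          refine Finset.sum_le_sum fun k hkN => ?_
          rw [lintegral_indicator_const (measurableSet_openAnnulus x _),
            ← ENNReal.ofReal_mul (inv_nonneg.2 hNr.le),
            ENNReal.ofReal_rpow_of_nonneg
              (mul_nonneg (inv_nonneg.2 hNr.le) (inv_nonneg.2 (hk k).le)) hp.le]
          refine (mul_le_mul_right (measure_mono (hsub k)) _).trans ?_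
          rw [← ENNReal.ofReal_toReal (hfin (2 ^ (k + 1) * r)), ← ENNReal.ofReal_mul
            (Real.rpow_nonneg (mul_nonneg (inv_nonneg.2 hNr.le) (inv_nonneg.2 (hk k).le)) _)]
          refine ENNReal.ofReal_le_ofReal ?_
          rw [Real.mul_rpow (inv_nonneg.2 hNr.le) (inv_nonneg.2 (hk k).le),
            Real.inv_rpow hNr.le, Real.inv_rpow (hk k).le, Real.rpow_neg hNr.le, mul_assoc]
          refine mul_le_mul_of_nonneg_left ?_ (by positivity)
          rw [mul_comm, ← div_eq_mul_inv]
          exact hM k (Finset.mem_range.1 hkN)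
      _ = ENNReal.ofReal ((N : ℝ) ^ (1 - p) * M) := by
          rw [Finset.sum_const, Finset.card_range, nsmul_eq_mul, ← ENNReal.ofReal_natCast,
            ← ENNReal.ofReal_mul hNr.le, sub_eq_add_neg, Real.rpow_add hNr, Real.rpow_one,
            mul_assoc]
  have hfinh : ∫⁻ y, h y ^ p ∂μ < ∞ := hint.trans_lt ENNReal.ofReal_lt_top
  have hzero : ∀ y ∉ ball x R, u y = 0 := by
    intro y hy
    rw [mem_ball, not_lt] at hy
    rw [hu]; dsimp only
    rw [Finset.sum_eq_zero, mul_zero]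
    intro k hkN
    refine radialCutoff_eq_zero (hk k) (le_trans ?_ (hR.trans hy))
    rw [← mul_assoc, ← pow_succ']
    exact mul_le_mul_of_nonneg_right
      (pow_le_pow_right₀ (by norm_num) (Finset.mem_range.1 hkN)) hr.le
  have hone : ∀ y ∈ ball x r, 1 ≤ u y := by
    intro y hy
    rw [hu]; dsimp only
    rw [Finset.sum_congr rfl fun k _ => radialCutoff_eq_one (hk k) (y := y) (x := x) ?_]
    · simp [hNr.ne']
    · refine (mem_ball.1 hy).le.trans ?_
      exact le_mul_of_one_le_left hr.le (one_le_pow₀ (by norm_num))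
  have habs : ∀ y, |u y| ≤ 1 := by
    intro y
    rw [hu]; dsimp only
    rw [abs_of_nonneg (mul_nonneg (inv_nonneg.2 hNr.le)
      (Finset.sum_nonneg fun k _ => radialCutoff_nonneg (hk k))), inv_mul_le_iff₀ hNr, mul_one]
    refine (Finset.sum_le_card_nsmul _ _ 1 fun k _ => radialCutoff_le_one (hk k)).trans ?_
    simp
  have hcont : Continuous u := by
    rw [hu]
    exact continuous_const.mul
      (continuous_finsetSum _ fun k _ => continuous_radialCutoff x _)
  have hadm : CapAdmissible μ p (ball x r) (ball x R) u := by
    refine ⟨⟨hcont.measurable.aemeasurable, ?_, h, hug, hfinh⟩, hzero, hone⟩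
    refine lt_of_le_of_lt (b := ∫⁻ y, (ball x R).indicator (fun _ => 1) y ∂μ) ?_ ?_
    · refine lintegral_mono fun y => ?_
      by_cases hy : y ∈ ball x R
      · rw [indicator_of_mem hy]
        exact ENNReal.rpow_le_one (ENNReal.ofReal_le_one.2 (habs y)) hp.le
      · simp [hzero y hy, hp]
    · rw [lintegral_indicator_const measurableSet_ball, one_mul]
      exact (hfin R).lt_top
  exact (varCap_le_lintegral hp hadm hug hfinh).trans hint

end Cutoff

/-! ### Replacing weak upper gradients by upper gradients, and localization. -/

section WeakUpperGradient

variable {X : Type*} [PseudoEMetricSpace X] [MeasurableSpace X] [BorelSpace X]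
  {μ : Measure X} {p : ℝ} {u : X → ℝ} {g : X → ℝ≥0∞}

/-- A weak upper gradient in `L^p` can be approximated in `L^p` by upper gradients from above. -/
theorem IsWeakUpperGradient.exists_isUpperGradient (hp : 1 ≤ p)
    (h : IsWeakUpperGradient μ p u g) {η : ℝ≥0∞} (hη : η ≠ 0) :
    ∃ k, IsUpperGradient u k ∧
      (∫⁻ y, k y ^ p ∂μ) ^ (1 / p) ≤ (∫⁻ y, g y ^ p ∂μ) ^ (1 / p) + η := by
  have hp0 : 0 < p := by linarith
  obtain ⟨g', hm, he, hg'⟩ := h.exists_measurable hp0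
  obtain ⟨ρ, hρm, hρf, hρ⟩ := hg'.2
  set A := (∫⁻ y, ρ y ^ p ∂μ) ^ (1 / p) with hA
  have hAf : A ≠ ∞ := ENNReal.rpow_ne_top_of_nonneg (by positivity) hρf.ne
  obtain ⟨ε, hε, hεA⟩ := ENNReal.exists_nnreal_pos_mul_lt hAf hη
  have hε0 : (ε : ℝ≥0∞) ≠ 0 := by exact_mod_cast hε.ne'
  -- On the exceptional curves ρ integrates to `∞`, so any positive multiple of it repairs the
  -- inequality; ε makes its L^p norm less than η.
  refine ⟨fun y => g' y + ε * ρ y, ⟨hm.add (hρm.const_mul _), fun γ => ?_⟩, ?_⟩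
  · by_cases hγ : UpperGradientIneq u g' γ
    · exact hγ.trans (lintegral_mono fun t => le_self_add)
    · have := hρ γ hγ
      refine le_top.trans ?_
      calc ∞ = ε * γ.lineIntegral ρ := by rw [this, ENNReal.mul_top hε0]
        _ ≤ ∫⁻ t in Icc 0 γ.len, ε * ρ (γ.toFun t) := lintegral_const_mul_le _ _
        _ ≤ _ := lintegral_mono fun t => le_add_self
  · have h1 := ENNReal.lintegral_Lp_add_le (μ := μ) hm.aemeasurable
      (hρm.const_mul (ε : ℝ≥0∞)).aemeasurable hp
    refine h1.trans ?_
    have e1 : ∫⁻ y, g' y ^ p ∂μ = ∫⁻ y, g y ^ p ∂μ :=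
      lintegral_congr_ae (he.mono fun y hy => (congrArg (· ^ p) hy).symm)
    have e2 : (∫⁻ y, (ε * ρ y) ^ p ∂μ) ^ (1 / p) = ε * A := by
      simp_rw [ENNReal.mul_rpow_of_nonneg _ _ hp0.le]
      rw [lintegral_const_mul _ (hρm.pow_const p),
        ENNReal.mul_rpow_of_nonneg _ _ (by positivity), ← ENNReal.rpow_mul,
        mul_one_div_cancel hp0.ne', ENNReal.rpow_one]
    rw [e1, e2]
    gcongr

/-- A weak upper gradient of a function vanishing outside an open set may be set to zero there. -/
theorem IsWeakUpperGradient.indicator (h : IsWeakUpperGradient μ p u g) {Ω : Set X}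
    (hΩ : IsOpen Ω) (hu : ∀ y ∉ Ω, u y = 0) :
    IsWeakUpperGradient μ p u (Ω.indicator g) := by
  refine ⟨h.1.indicator hΩ.measurableSet, h.2.subcurves.mono fun γ hγ => ?_⟩
  by_contra hcon
  simp only [mem_ofPred_eq, not_exists, not_not] at hcon
  apply hγ
  have hinc := fun {s t : ℝ} => ofReal_abs_sub_le_setLIntegral (s := s) (t := t) hcon
  -- T is the set of times spent outside Ω. If it is nonempty, u vanishes at its first and last
  -- times a and b, and the pieces before a and after b lie in Ω and control the two end values.
  set T := Icc 0 γ.len ∩ γ.toFun ⁻¹' Ωᶜ with hT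
  have hTc : IsCompact T := by
    refine isCompact_Icc.of_isClosed_subset ?_ inter_subset_left
    exact γ.continuousOn.preimage_isClosed_of_isClosed isClosed_Icc hΩ.isClosed_compl
  rcases T.eq_empty_or_nonempty with hemp | hne
  · have hmem : ∀ t ∈ Icc 0 γ.len, γ.toFun t ∈ Ω := by
      intro t ht
      by_contra hnot
      have : t ∈ T := ⟨ht, hnot⟩
      rw [hemp] at this
      exact this
    refine (hinc le_rfl γ.len_pos.le le_rfl).trans (le_of_eq ?_)
    exact setLIntegral_congr_fun measurableSet_Icc fun t ht =>
      (indicator_of_mem (hmem t ht) g).symm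
  · have h1 := hTc.sInf_mem hne
    have h2 := hTc.sSup_mem hne
    set a := sInf T
    set b := sSup T
    have ha : ∀ t ∈ Icc 0 γ.len, t < a → γ.toFun t ∈ Ω := by
      intro t ht hta
      by_contra hnot
      exact absurd (csInf_le hTc.bddBelow (⟨ht, hnot⟩ : t ∈ T)) (not_le.2 hta)
    have hb : ∀ t ∈ Icc 0 γ.len, b < t → γ.toFun t ∈ Ω := by
      intro t ht htb
      by_contra hnot
      exact absurd (le_csSup hTc.bddAbove (⟨ht, hnot⟩ : t ∈ T)) (not_le.2 htb)
    have hab : a ≤ b := csInf_le_csSup hne hTc.bddBelow hTc.bddAbove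
    have e1 : ENNReal.ofReal |u (γ.toFun 0)| ≤
        ∫⁻ t in Ico 0 a, Ω.indicator g (γ.toFun t) := by
      have := hinc le_rfl h1.1.1 h1.1.2
      rw [hu _ h1.2, sub_zero, ← setLIntegral_congr Ico_ae_eq_Icc] at this
      refine this.trans (le_of_eq ?_)
      exact setLIntegral_congr_fun measurableSet_Ico fun t ht =>
        (indicator_of_mem (ha t ⟨ht.1, ht.2.le.trans h1.1.2⟩ ht.2) g).symm
    have e2 : ENNReal.ofReal |u (γ.toFun γ.len)| ≤
        ∫⁻ t in Ioc b γ.len, Ω.indicator g (γ.toFun t) := by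
      have := hinc h2.1.1 h2.1.2 le_rfl
      rw [hu _ h2.2, zero_sub, abs_neg, ← setLIntegral_congr Ioc_ae_eq_Icc] at this
      refine this.trans (le_of_eq ?_)
      exact setLIntegral_congr_fun measurableSet_Ioc fun t ht =>
        (indicator_of_mem (hb t ⟨h2.1.1.trans ht.1.le, ht.2⟩ ht.1) g).symm
    calc ENNReal.ofReal |u (γ.toFun 0) - u (γ.toFun γ.len)|
        ≤ ENNReal.ofReal |u (γ.toFun 0)| + ENNReal.ofReal |u (γ.toFun γ.len)| := by
          rw [← ENNReal.ofReal_add (abs_nonneg _) (abs_nonneg _)]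
          exact ENNReal.ofReal_le_ofReal (abs_sub _ _)
      _ ≤ _ := add_le_add e1 e2
      _ = ∫⁻ t in Ico 0 a ∪ Ioc b γ.len, Ω.indicator g (γ.toFun t) := by
          rw [lintegral_union measurableSet_Ioc]
          rw [Set.disjoint_left]
          intro t ht ht'
          exact absurd (ht.2.trans_le hab) (not_lt.2 ht'.1.le)
      _ ≤ _ := lintegral_mono_set (union_subset (Ico_subset_Icc_self.trans
          (Icc_subset_Icc le_rfl h1.1.2)) (Ioc_subset_Icc_self.trans
          (Icc_subset_Icc h2.1.1 le_rfl)))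

end WeakUpperGradient

/-! ### Averages, nonempty annuli and reverse doubling. -/

/-- Comparison of the averages over a set and a superset of comparable measure. -/
theorem abs_setAverage_sub_setAverage_le {X : Type*} [MeasurableSpace X] {μ : Measure X}
    {u : X → ℝ} (hu : Integrable u μ) {S B : Set X} (hSB : S ⊆ B) (hB : μ B ≠ ∞) {D : ℝ}
    (hS : 0 < μ.real S) (hD : μ.real B ≤ D * μ.real S) :
    |⨍ y in S, u y ∂μ - ⨍ y in B, u y ∂μ| ≤ D * ⨍ y in B, |u y - ⨍ z in B, u z ∂μ| ∂μ := by
  set c := ⨍ z in B, u z ∂μ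
  have hSf : μ S ≠ ∞ := ne_top_of_le_ne_top hB (measure_mono hSB)
  have hBpos : 0 < μ.real B := hS.trans_le (measureReal_mono hSB hB)
  have hi : IntegrableOn (fun y => u y - c) B μ :=
    hu.integrableOn.sub (integrableOn_const hB)
  have e : ⨍ y in S, u y ∂μ - c = (μ.real S)⁻¹ * ∫ y in S, (u y - c) ∂μ := by
    rw [integral_sub hu.integrableOn (integrableOn_const hSf), setIntegral_const,
      setAverage_eq, smul_eq_mul, smul_eq_mul]
    field_simp
  rw [e, abs_mul, abs_of_pos (inv_pos.2 hS), setAverage_eq, smul_eq_mul]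
  calc (μ.real S)⁻¹ * |∫ y in S, (u y - c) ∂μ|
      ≤ (μ.real S)⁻¹ * ∫ y in B, |u y - c| ∂μ := by
        gcongr
        exact (abs_integral_le_integral_abs).trans
          (setIntegral_mono_set hi.abs (ae_of_all _ fun y => abs_nonneg _) hSB.eventuallyLE)
    _ ≤ (D * (μ.real B)⁻¹) * ∫ y in B, |u y - c| ∂μ := by
        refine mul_le_mul_of_nonneg_right ?_ (integral_nonneg fun y => abs_nonneg _)
        rw [inv_le_iff_one_le_mul₀ hS]
        have : D * (μ.real B)⁻¹ * μ.real S = (D * μ.real S) / μ.real B := by ring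
        rw [this, one_le_div hBpos]
        exact hD
    _ = _ := by ring

section Geometry

variable {X : Type*} [PseudoMetricSpace X] [MeasurableSpace X] {μ : Measure X}

theorem IsGloballyDoubling.exists_measure_ball_mul_le (h : IsGloballyDoubling μ) (L : ℝ) :
    ∃ D : ℝ≥0, 2 ≤ D ∧ ∀ (y : X) (s : ℝ), 0 < s → μ (ball y (L * s)) ≤ D * μ (ball y s) := by
  obtain ⟨C, hC⟩ := h
  obtain ⟨n, hn⟩ := pow_unbounded_of_one_lt L (one_lt_two (α := ℝ))
  have key : ∀ (m : ℕ) (y : X) (s : ℝ), 0 < s →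
      μ (ball y (2 ^ m * s)) ≤ (C : ℝ≥0∞) ^ m * μ (ball y s) := by
    intro m y s hs
    induction m with
    | zero => simp
    | succ m ih =>
      rw [pow_succ', mul_assoc]
      refine (hC y _ (by positivity)).trans ?_
      rw [pow_succ', mul_assoc]
      gcongr
  -- The maximum with 2 ensures D⁻¹ < 1, as reverse doubling requires.
  refine ⟨max (C ^ n) 2, le_max_right _ _, fun y s hs => ?_⟩
  refine (measure_mono (ball_subset_ball (mul_le_mul_of_nonneg_right hn.le hs.le))).trans
    ((key n y s hs).trans ?_)
  gcongr
  rw [← ENNReal.coe_pow, ENNReal.coe_le_coe]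
  exact le_max_left _ _

theorem IsGloballyDoubling.exists_measureReal_ball_mul_le (h : IsGloballyDoubling μ)
    (hfin : ∀ (y : X) (s : ℝ), μ (ball y s) ≠ ∞) (L : ℝ) :
    ∃ D : ℝ, 2 ≤ D ∧
      ∀ (y : X) (s : ℝ), 0 < s → μ.real (ball y (L * s)) ≤ D * μ.real (ball y s) := by
  obtain ⟨D, hD, H⟩ := h.exists_measure_ball_mul_le L
  refine ⟨D, by exact_mod_cast hD, fun y s hs => ?_⟩
  have := ENNReal.toReal_mono (ENNReal.mul_ne_top ENNReal.coe_ne_top (hfin y s)) (H y s hs)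
  simpa [Measure.real] using this

variable [BorelSpace X]

/-- Under a Poincaré inequality, annuli that do not contain the whole complement of a ball are
nonempty. -/
theorem SupportsPoincare.exists_dist_mem_Ico {p₀ : ℝ} (hp₀ : 0 < p₀) (hP : SupportsPoincare μ p₀)
    (hball : ∀ (y : X) (r : ℝ), 0 < r → 0 < μ (ball y r) ∧ μ (ball y r) < ∞)
    {x z : X} {s t : ℝ} (hs : 0 < s) (hst : s < t) (hz : t ≤ dist z x) :
    ∃ y, s ≤ dist y x ∧ dist y x < t := by
  by_contra! hcon
  obtain ⟨C, lam, -, -, H⟩ := hP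
  -- If no distance to x lay in [s, t), no curve could leave or enter B(x, s), so 0 would be an
  -- upper gradient of `f`. The Poincaré inequality would make `f` a.e. constant on a ball
  -- containing neighbourhoods of both x and z, where it equals 1 and 0.
  set f : X → ℝ := (ball x s).indicator fun _ => 1 with hf
  have hfi : Integrable f μ :=
    (integrable_indicator_iff measurableSet_ball).2 (integrableOn_const (hball x s hs).2.ne)
  have hug : IsUpperGradient f fun _ => 0 := by
    refine ⟨measurable_const, fun γ => ?_⟩
    have hc : ContinuousOn (fun t => dist (γ.toFun t) x) (Icc 0 γ.len) :=
      (LipschitzWith.dist_left x).continuous.comp_continuousOn γ.continuousOn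
    have hiff : γ.toFun 0 ∈ ball x s ↔ γ.toFun γ.len ∈ ball x s := by
      rw [mem_ball, mem_ball]
      have hno : ∀ τ ∈ Icc 0 γ.len, dist (γ.toFun τ) x ≠ s := fun τ _ he =>
        absurd (hcon _ he.ge) (by rw [he]; exact not_le.2 hst)
      have hiv := intermediate_value_uIcc (by rwa [uIcc_of_le γ.len_pos.le])
        (f := fun t => dist (γ.toFun t) x) (a := 0) (b := γ.len)
      rw [uIcc_of_le γ.len_pos.le] at hiv
      have hnot : s ∉ uIcc (dist (γ.toFun 0) x) (dist (γ.toFun γ.len) x) := fun hmem => by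
        obtain ⟨τ, hτ, he⟩ := hiv hmem
        exact hno τ hτ he
      rw [mem_uIcc] at hnot
      grind
    have : f (γ.toFun 0) = f (γ.toFun γ.len) := by
      by_cases h0 : γ.toFun 0 ∈ ball x s
      · rw [hf, indicator_of_mem h0, indicator_of_mem (hiff.1 h0)]
      · rw [hf, indicator_of_notMem h0, indicator_of_notMem (mt hiff.2 h0)]
    rw [UpperGradientIneq, this]
    simp
  set T := dist z x + t with hT
  have hTpos : 0 < T := by linarith [dist_nonneg (x := z) (y := x)]
  have h := H x T hTpos f hfi _ hug
  have hz0 : ENNReal.ofReal (C * T) *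
      (⨍⁻ y in ball x (lam * T), (0 : ℝ≥0∞) ^ p₀ ∂μ) ^ (1 / p₀) = 0 := by
    simp [hp₀]
  rw [hz0, nonpos_iff_eq_zero, ENNReal.ofReal_eq_zero] at h
  set c := ⨍ z in ball x T, f z ∂μ with hc
  have hTr : 0 < μ.real (ball x T) :=
    ENNReal.toReal_pos (hball x T hTpos).1.ne' (hball x T hTpos).2.ne
  rw [setAverage_eq, smul_eq_mul] at h
  have hint0 : ∫ y in ball x T, |f y - c| ∂μ = 0 := by
    have h1 : 0 ≤ ∫ y in ball x T, |f y - c| ∂μ := integral_nonneg fun y => abs_nonneg _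
    have h2 := inv_pos.2 hTr
    nlinarith
  have hi : IntegrableOn (fun y => |f y - c|) (ball x T) μ :=
    (hfi.integrableOn.sub (integrableOn_const (hball x T hTpos).2.ne)).abs
  rw [setIntegral_eq_zero_iff_of_nonneg_ae (ae_of_all _ fun y => abs_nonneg _) hi] at hint0
  have hval : ∀ (w : X) (τ v : ℝ), 0 < τ → ball w τ ⊆ ball x T → (∀ y ∈ ball w τ, f y = v) →
      v = c := by
    intro w τ v hτ hsub hv
    have h1 : ∀ᵐ y ∂μ.restrict (ball w τ), |f y - c| = 0 :=
      ae_mono (Measure.restrict_mono hsub le_rfl) hint0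
    have h2 := h1.and (ae_restrict_mem measurableSet_ball)
    have : (ae (μ.restrict (ball w τ))).NeBot := by
      rw [ae_neBot, Ne, Measure.restrict_eq_zero]
      exact (hball w τ hτ).1.ne'
    obtain ⟨y, hy1, hy2⟩ := h2.exists
    rw [abs_eq_zero, sub_eq_zero, hv y hy2] at hy1
    exact hy1
  have e1 := hval x s 1 hs (ball_subset_ball (by linarith [dist_nonneg (x := z) (y := x)]))
    fun y hy => by rw [hf, indicator_of_mem hy]
  have e2 := hval z (t - s) 0 (by linarith) (ball_subset_ball' (by linarith)) fun y hy => by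
    rw [hf, indicator_of_notMem]
    rw [mem_ball, not_lt]
    have := dist_triangle z y x
    rw [mem_ball, dist_comm] at hy
    linarith
  linarith

/-- A ball comparable to `B(x, s)` inside the annulus between the radii `s` and `2 s`. -/
theorem SupportsPoincare.exists_ball_subset_annulus {p₀ : ℝ} (hp₀ : 0 < p₀)
    (hP : SupportsPoincare μ p₀)
    (hball : ∀ (y : X) (r : ℝ), 0 < r → 0 < μ (ball y r) ∧ μ (ball y r) < ∞)
    {x z : X} {s : ℝ} (hs : 0 < s) (hz : 2 * s ≤ dist z x) :
    ∃ y, Disjoint (ball x s) (ball y (s / 4)) ∧ ball y (s / 4) ⊆ ball x (2 * s) ∧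
      ball x (2 * s) ⊆ ball y (16 * (s / 4)) := by
  -- The margin s/4 on both sides keeps B(y, s/4) between the radii s and 2s; since 2s + 7s/4 ≤ 4s,
  -- B(x, 2s) lies in B(y, 4s).
  obtain ⟨y, h1, h2⟩ := hP.exists_dist_mem_Ico hp₀ hball (s := 5 / 4 * s) (t := 7 / 4 * s)
    (by positivity) (by linarith) (by linarith : 7 / 4 * s ≤ dist z x)
  refine ⟨y, ball_disjoint_ball ?_, ball_subset_ball' (by linarith), ball_subset_ball' ?_⟩
  · rw [dist_comm]; linarith
  · rw [dist_comm]; linarith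

/-- Reverse doubling at radii small compared with the diameter. -/
theorem SupportsPoincare.exists_reverse_doubling {p₀ : ℝ} (hp₀ : 0 < p₀)
    (hP : SupportsPoincare μ p₀) (hdoubling : IsGloballyDoubling μ)
    (hball : ∀ (y : X) (r : ℝ), 0 < r → 0 < μ (ball y r) ∧ μ (ball y r) < ∞)
    {x z : X} {R₀ : ℝ} (hz : 2 * R₀ ≤ dist z x) :
    ∃ θ : ℝ, 0 < θ ∧ θ < 1 ∧ ∀ s, 0 < s → s ≤ R₀ →
      μ.real (ball x s) ≤ θ * μ.real (ball x (2 * s)) := by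
  have hfin : ∀ (y : X) (s : ℝ), μ (ball y s) ≠ ∞ := fun y s => by
    rcases le_or_gt s 0 with hs | hs
    · simp [ball_eq_empty.2 hs]
    · exact (hball y s hs).2.ne
  obtain ⟨D, hD, HD⟩ := hdoubling.exists_measureReal_ball_mul_le hfin 16
  have hD0 : 0 < D := by linarith
  have hDinv : D⁻¹ < 1 := inv_lt_one_of_one_lt₀ (by linarith)
  -- A ball in B(x, 2s) disjoint from B(x, s) occupies at least the fraction D⁻¹ of B(x, 2s).
  refine ⟨1 - D⁻¹, by linarith, by linarith [inv_pos.2 hD0], fun s hs hsR => ?_⟩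
  obtain ⟨y, h1, h2, h3⟩ := hP.exists_ball_subset_annulus hp₀ hball hs (by linarith : _ ≤ dist z x)
  have e1 := measureReal_union h1 (measurableSet_ball (x := y) (ε := s / 4))
    (h₁ := hfin _ _) (h₂ := hfin _ _)
  have e2 : μ.real (ball x s ∪ ball y (s / 4)) ≤ μ.real (ball x (2 * s)) :=
    measureReal_mono (union_subset (ball_subset_ball (by linarith)) h2) (hfin _ _)
  have e3 : μ.real (ball x (2 * s)) ≤ D * μ.real (ball y (s / 4)) :=
    (measureReal_mono h3 (hfin _ _)).trans (HD y (s / 4) (by positivity))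
  have e4 : D⁻¹ * μ.real (ball x (2 * s)) ≤ μ.real (ball y (s / 4)) := by
    rwa [inv_mul_le_iff₀ hD0]
  linarith

end Geometry

/-! ### Summing Poincaré terms over overlapping balls. -/

theorem ENNReal.finset_sum_rpow_le {ι : Type*} (s : Finset ι) (f : ι → ℝ≥0∞) {q : ℝ}
    (hq : 0 < q) (hq1 : q ≤ 1) : (∑ i ∈ s, f i) ^ q ≤ ∑ i ∈ s, f i ^ q := by
  classical
  induction s using Finset.induction_on with
  | empty => simp [hq]
  | insert i s hi ih =>
    rw [Finset.sum_insert hi, Finset.sum_insert hi]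
    refine (ENNReal.rpow_add_le_add_rpow _ _ hq.le hq1).trans ?_
    gcongr

/-- Discrete convolution with a geometric sequence is bounded on `ℓ¹`. -/
theorem ENNReal.sum_geometric_convolution_le (τ : ℝ≥0∞) (β : ℕ → ℝ≥0∞) (n : ℕ) :
    ∑ k ∈ Finset.range n, ∑ j ∈ Finset.range (k + 1), τ ^ (k - j) * β j ≤
      (1 - τ)⁻¹ * ∑ j ∈ Finset.range n, β j := by
  rw [Finset.sum_comm' (s' := fun j => Finset.Ico j n) (t' := Finset.range n)
    (by intro k j; simp only [Finset.mem_range, Finset.mem_Ico]; omega), Finset.mul_sum]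
  refine Finset.sum_le_sum fun j _ => ?_
  rw [← Finset.sum_mul, Finset.sum_Ico_eq_sum_range, ← ENNReal.tsum_geometric]
  gcongr
  refine le_trans (le_of_eq ?_) (ENNReal.sum_le_tsum (Finset.range (n - j)))
  exact Finset.sum_congr rfl fun i _ => by rw [Nat.add_sub_cancel_left]

section Hoelder

variable {X : Type*} [MeasurableSpace X] {μ : Measure X} {p₀ p : ℝ}

/-- For p₀ < p the power of `μ A` is a gain on small pieces; it is what later compensates the
overlap of the balls. -/
theorem setLIntegral_rpow_le {h : X → ℝ≥0∞} (hh : Measurable h) (hp₀ : 0 < p₀) (hp : p₀ ≤ p)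
    (A : Set X) :
    (∫⁻ y in A, h y ^ p₀ ∂μ) ^ (1 / p₀) ≤
      (∫⁻ y in A, h y ^ p ∂μ) ^ (1 / p) * μ A ^ (1 / p₀ - 1 / p) := by
  have := eLpNorm'_le_eLpNorm'_mul_rpow_measure_univ (μ := μ.restrict A) (f := h) hp₀ hp
    hh.aestronglyMeasurable
  simpa [eLpNorm'] using this

/-- Hölder's inequality on each piece of a finite cover. -/
theorem setLAverage_rpow_le_sum {h : X → ℝ≥0∞} (hh : Measurable h) (hp₀ : 1 ≤ p₀) (hp : p₀ ≤ p)
    {S : Set X} {A : ℕ → Set X} {n : ℕ} (hS : S ⊆ ⋃ j ∈ Finset.range n, A j)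
    (hS0 : μ S ≠ 0) (hSf : μ S ≠ ∞) :
    (⨍⁻ y in S, h y ^ p₀ ∂μ) ^ (1 / p₀) ≤
      ∑ j ∈ Finset.range n, (μ (A j) / μ S) ^ (1 / p₀ - 1 / p) *
        ((∫⁻ y in A j, h y ^ p ∂μ) / μ S) ^ (1 / p) := by
  have h0 : 0 < p₀ := by linarith
  have hp0 : 0 < p := by linarith
  have hδ : 0 ≤ 1 / p₀ - 1 / p := sub_nonneg.2 (one_div_le_one_div_of_le h0 hp)
  have hle : ⨍⁻ y in S, h y ^ p₀ ∂μ ≤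
      ∑ j ∈ Finset.range n, (∫⁻ y in A j, h y ^ p₀ ∂μ) / μ S := by
    rw [setLAverage_eq]
    simp_rw [div_eq_mul_inv]
    rw [← Finset.sum_mul]
    gcongr
    refine (lintegral_mono_set hS).trans ?_
    have := lintegral_iUnion_le (μ := μ) (fun j : Finset.range n => A j) fun y => h y ^ p₀
    rw [tsum_fintype, Finset.sum_coe_sort (Finset.range n)
      (fun j => ∫⁻ y in A j, h y ^ p₀ ∂μ)] at this
    rwa [iUnion_subtype] at this
  refine (ENNReal.rpow_le_rpow hle (by positivity)).trans
    ((ENNReal.finset_sum_rpow_le _ _ (by positivity) ((div_le_one h0).2 hp₀)).trans ?_)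
  refine Finset.sum_le_sum fun j _ => ?_
  have e : μ S ^ (1 / p₀) = μ S ^ (1 / p) * μ S ^ (1 / p₀ - 1 / p) := by
    rw [← ENNReal.rpow_add _ _ hS0 hSf]; congr 1; ring
  rw [ENNReal.div_rpow_of_nonneg _ _ (by positivity), ENNReal.div_rpow_of_nonneg _ _ hδ,
    ENNReal.div_rpow_of_nonneg _ _ (by positivity), e]
  refine (ENNReal.div_le_div_right (setLIntegral_rpow_le hh h0 hp (A j)) _).trans (le_of_eq ?_)
  have hne : μ S ^ (1 / p) ≠ 0 := by simp [ENNReal.rpow_eq_zero_iff, hS0, hSf]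
  have hnt : μ S ^ (1 / p) ≠ ∞ := ENNReal.rpow_ne_top_of_nonneg (by positivity) hSf
  generalize μ S ^ (1 / p) = a at *
  generalize μ S ^ (1 / p₀ - 1 / p) = b at *
  simp only [ENNReal.div_eq_inv_mul]
  rw [ENNReal.mul_inv (Or.inl hne) (Or.inl hnt)]
  ring

/-- Sum of Poincaré-type terms over an increasing sequence of sets with geometrically increasing
measures. The loss is only `n ^ (p - 1)` since `p₀ < p`. -/
theorem sum_mul_setLAverage_rpow_le {h : X → ℝ≥0∞} (hh : Measurable h) (hp₀ : 1 ≤ p₀)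
    (hp : p₀ < p) {V : ℕ → Set X} (hVm : ∀ k, MeasurableSet (V k)) (hV : Monotone V)
    (hV0 : ∀ k, μ (V k) ≠ 0) (hVf : ∀ k, μ (V k) ≠ ∞) {n : ℕ} {K τ M : ℝ≥0∞} {ρ : ℕ → ℝ≥0∞}
    (hρ : ∀ k < n, ρ k ^ p ≤ M * μ (V k))
    (hdec : ∀ j k, j ≤ k → k < n → μ (V j) ≤ K * τ ^ (k - j) * μ (V k)) :
    ∑ k ∈ Finset.range n, ρ k * (⨍⁻ y in V k, h y ^ p₀ ∂μ) ^ (1 / p₀) ≤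
      K ^ (1 / p₀ - 1 / p) * (1 - τ ^ (1 / p₀ - 1 / p))⁻¹ *
        (M * ((n : ℝ≥0∞) ^ (p - 1) * ∫⁻ y, h y ^ p ∂μ)) ^ (1 / p) := by
  have h0 : 0 < p₀ := by linarith
  have hp0 : 0 < p := by linarith
  have hδ : 0 ≤ 1 / p₀ - 1 / p := sub_nonneg.2 (one_div_le_one_div_of_le h0 hp.le)
  set δ := 1 / p₀ - 1 / p
  set A := disjointed V
  have hAm : ∀ j, MeasurableSet (A j) := fun j => MeasurableSet.disjointed hVm j
  set b : ℕ → ℝ≥0∞ := fun j => ∫⁻ y in A j, h y ^ p ∂μ with hb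
  have hcover : ∀ k, V k ⊆ ⋃ j ∈ Finset.range (k + 1), A j := by
    intro k
    have h1 : partialSups V k = V k := congrFun hV.partialSups_eq k
    have h2 := biUnion_range_succ_disjointed V k
    have h3 : (⋃ j ∈ Finset.range (k + 1), A j) = partialSups V k := by
      rw [← h2]
    rw [h3, h1]
  -- The shell j contributes to the k-th ball with weight τ^{δ(k-j)}; summed over k this is a
  -- geometric series, so each shell counts only boundedly often.
  have hterm : ∀ k < n, ∀ j ∈ Finset.range (k + 1),
      ρ k * ((μ (A j) / μ (V k)) ^ δ * (b j / μ (V k)) ^ (1 / p)) ≤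
        K ^ δ * M ^ (1 / p) * ((τ ^ δ) ^ (k - j) * b j ^ (1 / p)) := by
    intro k hk j hj
    have hjk : j ≤ k := Nat.lt_succ_iff.1 (Finset.mem_range.1 hj)
    have e1 : (μ (A j) / μ (V k)) ^ δ ≤ K ^ δ * (τ ^ δ) ^ (k - j) := by
      have : μ (A j) / μ (V k) ≤ K * τ ^ (k - j) :=
        ENNReal.div_le_of_le_mul ((measure_mono (disjointed_subset V j)).trans (hdec j k hjk hk))
      refine (ENNReal.rpow_le_rpow this hδ).trans (le_of_eq ?_)
      rw [ENNReal.mul_rpow_of_nonneg _ _ hδ, ← ENNReal.rpow_natCast, ← ENNReal.rpow_natCast,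
        ← ENNReal.rpow_mul, ← ENNReal.rpow_mul, mul_comm δ]
    have e2 : ρ k * (b j / μ (V k)) ^ (1 / p) ≤ M ^ (1 / p) * b j ^ (1 / p) := by
      have : ρ k = (ρ k ^ p) ^ (1 / p) := by
        rw [← ENNReal.rpow_mul, mul_one_div_cancel hp0.ne', ENNReal.rpow_one]
      rw [this, ← ENNReal.mul_rpow_of_nonneg _ _ (by positivity),
        ← ENNReal.mul_rpow_of_nonneg _ _ (by positivity)]
      refine ENNReal.rpow_le_rpow ?_ (by positivity)
      refine (mul_le_mul_left (hρ k hk) _).trans ?_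
      rw [mul_assoc]
      gcongr
      exact ENNReal.mul_div_le
    calc ρ k * ((μ (A j) / μ (V k)) ^ δ * (b j / μ (V k)) ^ (1 / p))
        = (μ (A j) / μ (V k)) ^ δ * (ρ k * (b j / μ (V k)) ^ (1 / p)) := by ring
      _ ≤ (K ^ δ * (τ ^ δ) ^ (k - j)) * (M ^ (1 / p) * b j ^ (1 / p)) := by gcongr
      _ = _ := by ring
  have hsumb : ∑ j ∈ Finset.range n, b j ≤ ∫⁻ y, h y ^ p ∂μ := by
    rw [hb, ← lintegral_biUnion_finset (fun i _ j _ hij => disjoint_disjointed V hij)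
      (fun j _ => hAm j)]
    exact setLIntegral_le_lintegral _ _
  -- The power mean inequality over n terms, the source of the factor n^(p-1).
  have hl1 : ∑ j ∈ Finset.range n, b j ^ (1 / p) ≤
      ((n : ℝ≥0∞) ^ (p - 1) * ∫⁻ y, h y ^ p ∂μ) ^ (1 / p) := by
    rw [one_div, ENNReal.le_rpow_inv_iff hp0]
    refine (ENNReal.rpow_sum_le_const_mul_sum_rpow _ _ (by linarith)).trans ?_
    rw [Finset.card_range]
    gcongr
    refine le_trans (le_of_eq ?_) hsumb
    exact Finset.sum_congr rfl fun j _ => ENNReal.rpow_inv_rpow hp0.ne' _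
  calc ∑ k ∈ Finset.range n, ρ k * (⨍⁻ y in V k, h y ^ p₀ ∂μ) ^ (1 / p₀)
      ≤ ∑ k ∈ Finset.range n, ∑ j ∈ Finset.range (k + 1),
          K ^ δ * M ^ (1 / p) * ((τ ^ δ) ^ (k - j) * b j ^ (1 / p)) := by
        refine Finset.sum_le_sum fun k hk => ?_
        refine (mul_le_mul_right (setLAverage_rpow_le_sum hh hp₀ hp.le (hcover k) (hV0 k)
          (hVf k)) _).trans ?_
        rw [Finset.mul_sum]
        exact Finset.sum_le_sum fun j hj => hterm k (Finset.mem_range.1 hk) j hj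
    _ = K ^ δ * M ^ (1 / p) * ∑ k ∈ Finset.range n, ∑ j ∈ Finset.range (k + 1),
          (τ ^ δ) ^ (k - j) * b j ^ (1 / p) := by
        simp_rw [← Finset.mul_sum]
    _ ≤ K ^ δ * M ^ (1 / p) * ((1 - τ ^ δ)⁻¹ *
          ((n : ℝ≥0∞) ^ (p - 1) * ∫⁻ y, h y ^ p ∂μ) ^ (1 / p)) := by
        gcongr
        refine (ENNReal.sum_geometric_convolution_le _ _ _).trans ?_
        gcongr
    _ = _ := by
        rw [ENNReal.mul_rpow_of_nonneg M _ (by positivity)]; ring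

end Hoelder

/-! ### Telescoping of averages and the lower capacity estimate. -/

section Telescoping

variable {X : Type*} [MeasurableSpace X] {μ : Measure X}

/-- The mean oscillation of `u` over the set `B`. -/
noncomputable def meanOscillation (μ : Measure X) (u : X → ℝ) (B : Set X) : ℝ :=
  ⨍ y in B, |u y - ⨍ z in B, u z ∂μ| ∂μ

theorem meanOscillation_nonneg (u : X → ℝ) (B : Set X) : 0 ≤ meanOscillation μ u B := by
  rw [meanOscillation, setAverage_eq]
  exact smul_nonneg (by positivity) (integral_nonneg fun y => abs_nonneg _)

/-- Telescoping estimate for averages along an increasing chain of sets. -/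
theorem abs_setAverage_sub_setAverage_le_sum {u : X → ℝ} (hu : Integrable u μ) {B : ℕ → Set X}
    (hB : Monotone B) (hf : ∀ k, μ (B k) ≠ ∞) (h0 : ∀ k, 0 < μ.real (B k)) {D : ℝ}
    (hD : ∀ k, μ.real (B (k + 1)) ≤ D * μ.real (B k)) (n : ℕ) :
    |⨍ y in B 0, u y ∂μ - ⨍ y in B n, u y ∂μ| ≤
      D * ∑ k ∈ Finset.range n, meanOscillation μ u (B (k + 1)) := by
  induction n with
  | zero => simp
  | succ n ih =>
    rw [Finset.sum_range_succ, mul_add]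
    refine (abs_sub_le _ (⨍ y in B n, u y ∂μ) _).trans (add_le_add ih ?_)
    exact abs_setAverage_sub_setAverage_le hu (hB n.le_succ) (hf _) (h0 n) (hD n)

end Telescoping

section LowerBound

/-- The Poincaré inequality is assumed for integrable functions; an L^p function vanishing outside a
set of finite measure is one. -/
theorem CapAdmissible.integrable {X : Type*} [PseudoMetricSpace X] [MeasurableSpace X]
    {μ : Measure X} {p : ℝ} (hp : 1 ≤ p) {E Ω : Set X} {u : X → ℝ}
    (h : CapAdmissible μ p E Ω u) (hf : μ Ω ≠ ∞) : Integrable u μ := by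
  have hmem : MemLp u (ENNReal.ofReal p) μ := by
    refine ⟨h.1.1.aestronglyMeasurable, ?_⟩
    rw [eLpNorm_lt_top_iff_lintegral_rpow_enorm_lt_top (by simp; linarith) ENNReal.ofReal_ne_top,
      ENNReal.toReal_ofReal (by linarith)]
    simpa [Real.enorm_eq_ofReal_abs] using h.1.2.1
  have : IntegrableOn u Ω μ := by
    have : IsFiniteMeasure (μ.restrict Ω) := ⟨by simpa using hf.lt_top⟩
    exact (hmem.restrict Ω).integrable (by simpa using ENNReal.ofReal_le_ofReal hp)
  refine (integrableOn_iff_integrable_of_support_subset fun y hy => ?_).1 this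
  by_contra hn
  exact hy (h.2.1 y hn)

variable {X : Type*} [PseudoMetricSpace X] [MeasurableSpace X] [BorelSpace X] {μ : Measure X}
  {p₀ p : ℝ}

/-- Energy estimate for upper gradients of functions which are at least `1` on the ball
`B(x, r)` and vanish outside the ball `B(x, R)`, where `2 R = 2 ^ N r`. -/
theorem SupportsPoincare.exists_one_le_energy
    (hball : ∀ (y : X) (r : ℝ), 0 < r → 0 < μ (ball y r) ∧ μ (ball y r) < ∞)
    (hdoubling : IsGloballyDoubling μ) (hp₀ : 1 ≤ p₀) (hp : p₀ < p)
    (hP : SupportsPoincare μ p₀) {x z : X} {R₀ : ℝ} (hz : 2 * R₀ ≤ dist z x) :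
    ∃ K : ℝ≥0∞, K ≠ ∞ ∧ ∀ (r R : ℝ) (N : ℕ) (M : ℝ≥0∞), 0 < r → 2 ^ N * r = 2 * R →
      R ≤ R₀ →
      (∀ k ≤ N, ENNReal.ofReal ((2 ^ k * r) ^ p) ≤ M * μ (ball x (2 ^ k * r))) →
      ∀ (u : X → ℝ) (h : X → ℝ≥0∞), Integrable u μ → IsUpperGradient u h →
        (∀ y ∈ ball x r, 1 ≤ u y) → (∀ y ∉ ball x R, u y = 0) →
        1 ≤ K * (M * (((N + 1 : ℕ) : ℝ≥0∞) ^ (p - 1) * ∫⁻ y, h y ^ p ∂μ)) ^ (1 / p) := by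
  have h0 : 0 < p₀ := by linarith
  have hp0 : 0 < p := by linarith
  have hfin : ∀ (y : X) (s : ℝ), μ (ball y s) ≠ ∞ := fun y s => by
    rcases le_or_gt s 0 with hs | hs
    · simp [ball_eq_empty.2 hs]
    · exact (hball y s hs).2.ne
  have hposr : ∀ (y : X) (s : ℝ), 0 < s → 0 < μ.real (ball y s) := fun y s hs =>
    ENNReal.toReal_pos (hball y s hs).1.ne' (hfin y s)
  have hδ : 0 < 1 / p₀ - 1 / p := sub_pos.2 (one_div_lt_one_div_of_lt h0 hp)
  obtain ⟨θ, hθ0, hθ1, hθ⟩ := hP.exists_reverse_doubling h0 hdoubling hball hz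
  obtain ⟨D, hD2, hD⟩ := hdoubling.exists_measureReal_ball_mul_le hfin 16
  have hP' := hP
  obtain ⟨C, lam, hC, hlam, H⟩ := hP
  obtain ⟨L, -, hL⟩ := hdoubling.exists_measure_ball_mul_le lam
  have hθe : ENNReal.ofReal θ < 1 := ENNReal.ofReal_lt_one.2 hθ1
  set δ := 1 / p₀ - 1 / p
  have hτ : ENNReal.ofReal θ ^ δ < 1 := ENNReal.rpow_lt_one hθe hδ
  refine ⟨ENNReal.ofReal (2 * D * C) * ((L : ℝ≥0∞) ^ δ * (1 - ENNReal.ofReal θ ^ δ)⁻¹), ?_, ?_⟩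
  · refine ENNReal.mul_ne_top ENNReal.ofReal_ne_top (ENNReal.mul_ne_top
      (ENNReal.rpow_ne_top_of_nonneg hδ.le ENNReal.coe_ne_top) ?_)
    exact ENNReal.inv_ne_top.2 (tsub_pos_of_lt hτ).ne'
  intro r R N M hr hNR hRR₀ hM u h hu hh hu1 hu0
  set ρ : ℕ → ℝ := fun k => 2 ^ k * r with hρ
  have hρpos : ∀ k, 0 < ρ k := fun k => by positivity
  have hρmono : Monotone ρ := fun i j hij => by
    simp only [hρ]
    exact mul_le_mul_of_nonneg_right (pow_le_pow_right₀ (by norm_num) hij) hr.le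
  have hρs : ∀ k, ρ (k + 1) = 2 * ρ k := fun k => by simp only [hρ]; ring
  have hRpos : 0 < R := by have := hρpos N; simp only [hρ, hNR] at this; linarith
  have hBmono : Monotone fun k => ball x (ρ k) := fun i j hij => ball_subset_ball (hρmono hij)
  have hDinc : ∀ (y : X) (s t : ℝ), 0 < s → t ≤ 16 * s →
      μ.real (ball y t) ≤ D * μ.real (ball y s) := fun y s t hs ht =>
    (measureReal_mono (ball_subset_ball ht) (hfin _ _)).trans (hD y s hs)
  -- the ball outside the support
  obtain ⟨w, hw1, hw2, hw3⟩ := hP'.exists_ball_subset_annulus h0 hball hRpos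
    (by linarith : 2 * R ≤ dist z x)
  have hρN : ρ N = 2 * R := hNR
  have hlast := abs_setAverage_sub_setAverage_le hu (S := ball w (R / 4)) (B := ball x (ρ N))
    (by rw [hρN]; exact hw2) (hfin _ _) (D := D) (hposr _ _ (by positivity)) (by
      rw [hρN]
      exact (measureReal_mono hw3 (hfin _ _)).trans (hD w (R / 4) (by positivity)))
  have hchain := abs_setAverage_sub_setAverage_le_sum hu hBmono (fun k => hfin x (ρ k))
    (fun k => hposr x _ (hρpos k)) (D := D)
    (fun k => hDinc x (ρ k) (ρ (k + 1)) (hρpos k) (by rw [hρs]; linarith [hρpos k])) N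
  have hw0 : ⨍ y in ball w (R / 4), u y ∂μ = 0 := by
    rw [setAverage_eq, setIntegral_eq_zero_of_forall_eq_zero, smul_zero]
    intro y hy
    exact hu0 y fun hyR => disjoint_left.1 hw1 hyR hy
  have hge : 1 ≤ ⨍ y in ball x (ρ 0), u y ∂μ := by
    have e0 : ρ 0 = r := by simp [hρ]
    rw [e0, setAverage_eq, smul_eq_mul, le_inv_mul_iff₀ (hposr x r hr), mul_one]
    calc μ.real (ball x r) = ∫ y in ball x r, (1 : ℝ) ∂μ := by simp
      _ ≤ ∫ y in ball x r, u y ∂μ :=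
        setIntegral_mono_on (integrableOn_const (hfin x r)) hu.integrableOn measurableSet_ball hu1
  have hosc : ∀ k, 0 ≤ meanOscillation μ u (ball x (ρ k)) := fun k => meanOscillation_nonneg _ _
  set O := ∑ k ∈ Finset.range (N + 1), meanOscillation μ u (ball x (ρ k)) with hO
  have hS1 : ∑ k ∈ Finset.range N, meanOscillation μ u (ball x (ρ (k + 1))) ≤ O := by
    rw [hO, Finset.sum_range_succ']
    exact le_add_of_nonneg_right (hosc 0)
  have hS2 : meanOscillation μ u (ball x (ρ N)) ≤ O :=
    Finset.single_le_sum (f := fun k => meanOscillation μ u (ball x (ρ k)))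
      (fun k _ => hosc k) (Finset.self_mem_range_succ N)
  have hD0 : 0 ≤ D := by linarith
  -- One D Σ pays for the chain up to B(x, 2R), the other for the jump from there to the ball on
  -- which u = 0.
  have hone : 1 ≤ 2 * D * O := by
    rw [hw0, zero_sub, abs_neg] at hlast
    have h1 := (abs_le.1 hchain).2
    have h2 := (le_abs_self _).trans hlast
    have h3 := mul_le_mul_of_nonneg_left hS1 hD0
    have h4 := mul_le_mul_of_nonneg_left hS2 hD0
    rw [meanOscillation] at h4
    linarith
  -- the Poincaré inequality on each ball
  set V : ℕ → Set X := fun k => ball x (lam * ρ k) with hV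
  have hlam0 : 0 < lam := by linarith
  have hlk : ∀ k, ρ k ≤ lam * ρ k := fun k => le_mul_of_one_le_left (hρpos k).le hlam
  have hBV : ∀ k, μ (ball x (ρ k)) ≤ μ (V k) := fun k => measure_mono (ball_subset_ball (hlk k))
  have hrev : ∀ j n, j + n ≤ N → μ.real (ball x (ρ j)) ≤ θ ^ n * μ.real (ball x (ρ (j + n))) := by
    intro j n
    induction n with
    | zero => intro _; simp
    | succ n ih =>
      intro hjn
      refine (ih (by omega)).trans ?_
      -- Reverse doubling is available only up to R₀; the next radius is at most 2R, so this one is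
      -- at most R.
      have hle : ρ (j + n) ≤ R₀ := by
        have := hρmono (show j + n + 1 ≤ N by omega)
        rw [hρs, hρN] at this
        linarith
      have := hθ (ρ (j + n)) (hρpos _) hle
      rw [← hρs] at this
      rw [pow_succ, mul_assoc]
      exact mul_le_mul_of_nonneg_left this (by positivity)
  -- The dilated radii may exceed R₀, so the decay is proved for the undilated balls and transferred
  -- by doubling, at the cost of L.
  have hdec : ∀ j k, j ≤ k → k < N + 1 → μ (V j) ≤ L * ENNReal.ofReal θ ^ (k - j) * μ (V k) := by
    intro j k hjk hkN
    have h1 := hrev j (k - j) (by omega)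
    rw [Nat.add_sub_of_le hjk] at h1
    have h2 := ENNReal.ofReal_le_ofReal h1
    rw [ENNReal.ofReal_mul (by positivity), ENNReal.ofReal_pow hθ0.le, ofReal_measureReal (hfin _ _),
      ofReal_measureReal (hfin _ _)] at h2
    calc μ (V j) ≤ L * μ (ball x (ρ j)) := hL x _ (hρpos j)
      _ ≤ L * (ENNReal.ofReal θ ^ (k - j) * μ (V k)) := by
        gcongr
        exact h2.trans (mul_le_mul_right (hBV k) _)
      _ = _ := by ring
  have hmain := sum_mul_setLAverage_rpow_le (μ := μ) hh.1 hp₀ hp (V := V)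
    (fun k => measurableSet_ball)
    (fun i j hij => ball_subset_ball (mul_le_mul_of_nonneg_left (hρmono hij) hlam0.le))
    (fun k => (hball x _ (mul_pos hlam0 (hρpos k))).1.ne') (fun k => hfin _ _)
    (n := N + 1) (K := L) (τ := ENNReal.ofReal θ) (M := M) (ρ := fun k => ENNReal.ofReal (ρ k))
    (fun k hk => by
      rw [ENNReal.ofReal_rpow_of_nonneg (hρpos k).le hp0.le]
      exact (hM k (Nat.lt_succ_iff.1 hk)).trans (mul_le_mul_right (hBV k) _)) hdec
  have hpoin : ENNReal.ofReal O ≤ ENNReal.ofReal C * ∑ k ∈ Finset.range (N + 1),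
      ENNReal.ofReal (ρ k) * (⨍⁻ y in V k, h y ^ p₀ ∂μ) ^ (1 / p₀) := by
    rw [hO, ENNReal.ofReal_sum_of_nonneg fun k _ => hosc k, Finset.mul_sum]
    refine Finset.sum_le_sum fun k _ => ?_
    rw [← mul_assoc, ← ENNReal.ofReal_mul hC.le]
    exact H x (ρ k) (hρpos k) u hu h hh
  calc (1 : ℝ≥0∞) = ENNReal.ofReal 1 := by simp
    _ ≤ ENNReal.ofReal (2 * D * O) := ENNReal.ofReal_le_ofReal hone
    _ = ENNReal.ofReal (2 * D) * ENNReal.ofReal O := ENNReal.ofReal_mul (by positivity)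
    _ ≤ ENNReal.ofReal (2 * D) * (ENNReal.ofReal C * _) :=
      mul_le_mul_right (hpoin.trans (mul_le_mul_right hmain _)) _
    _ = _ := by
      rw [ENNReal.ofReal_mul (by positivity : 0 ≤ 2 * D)]
      simp only [mul_assoc]
      rfl

/-- Lower capacity estimate for annuli, with logarithmic dependence on the ratio of the radii. -/
theorem SupportsPoincare.exists_le_varCap
    (hball : ∀ (y : X) (r : ℝ), 0 < r → 0 < μ (ball y r) ∧ μ (ball y r) < ∞)
    (hdoubling : IsGloballyDoubling μ) (hp₀ : 1 ≤ p₀) (hp : p₀ < p)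
    (hP : SupportsPoincare μ p₀) {x z : X} {R₀ : ℝ} (hz : 2 * R₀ ≤ dist z x) :
    ∃ c : ℝ, 0 < c ∧ ∀ r R M : ℝ, 0 < r → 2 * r ≤ R → R ≤ R₀ → 0 < M →
      (∀ s, r / 2 ≤ s → s ≤ 2 * R → s ^ p ≤ M * μ.real (ball x s)) →
      ENNReal.ofReal (c * (M⁻¹ * Real.log (R / r) ^ (1 - p))) ≤
        varCap μ p (ball x r) (ball x R) := by
  obtain ⟨K, hK, H⟩ := hP.exists_one_le_energy hball hdoubling hp₀ hp hz
  have hp0 : 0 < p := by linarith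
  have hfin : ∀ (y : X) (s : ℝ), μ (ball y s) ≠ ∞ := fun y s => by
    rcases le_or_gt s 0 with hs | hs
    · simp [ball_eq_empty.2 hs]
    · exact (hball y s hs).2.ne
  set k := K.toReal ^ p + 1 with hk
  have hk0 : 0 < k := by positivity
  refine ⟨(k * 8 ^ (p - 1))⁻¹, by positivity, fun r R M hr hrR hRR₀ hM0 hM => ?_⟩
  have hR0 : 0 < R := by linarith
  have hone : 1 ≤ 2 * R / r := by rw [one_le_div hr]; linarith
  obtain ⟨n, hn1, hn2⟩ := exists_nat_pow_near hone (one_lt_two (α := ℝ))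
  -- The starting radius is lowered to some r' in [r/2, r] so that the dyadic chain ends exactly at
  -- 2R.
  set r' := 2 * R / 2 ^ (n + 1) with hr'
  have hr'0 : 0 < r' := by positivity
  have hNr : 2 ^ (n + 1) * r' = 2 * R := by rw [hr']; field_simp
  have hr'r : r' ≤ r := by
    rw [hr', div_le_iff₀ (by positivity)]
    rw [div_lt_iff₀ hr] at hn2
    linarith
  have hrr' : r / 2 ≤ r' := by
    rw [hr', le_div_iff₀ (by positivity), pow_succ]
    rw [le_div_iff₀ hr] at hn1
    linarith
  set l := Real.log (R / r) with hl
  have hlog2 : (0.69 : ℝ) < Real.log 2 := by linarith [Real.log_two_gt_d9]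
  have hl2 : Real.log 2 ≤ l := Real.log_le_log (by norm_num) (by rw [le_div_iff₀ hr]; linarith)
  have hl0 : 0 < l := by linarith
  -- There are n + 2 balls in the chain, and n log 2 ≤ log 2 + l; since l ≥ log 2 > 0.69, the
  -- additive constants are absorbed into 8 l.
  have hcard : ((n + 1 + 1 : ℕ) : ℝ) ≤ 8 * l := by
    have h1 := Real.log_le_log (by positivity) hn1
    rw [Real.log_pow, mul_div_assoc, Real.log_mul (by norm_num) (by positivity)] at h1
    have h2 : (n : ℝ) * 0.69 ≤ n * Real.log 2 := by gcongr
    push_cast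
    linarith
  refine le_iInf₂ fun u hu => le_iInf₂ fun g hg => ?_
  have hui := hu.integrable (by linarith) (hfin x R)
  have hw := hg.1.indicator isOpen_ball hu.2.1
  set E := ∫⁻ y in ball x R, g y ^ p ∂μ with hE
  have hEind : ∫⁻ y, (ball x R).indicator g y ^ p ∂μ = E := by
    rw [hE, ← lintegral_indicator measurableSet_ball]
    refine lintegral_congr fun y => ?_
    by_cases hy : y ∈ ball x R <;> simp [hy, hp0]
  have hEf : E ≠ ∞ := ((setLIntegral_le_lintegral _ _).trans_lt hg.2.1).ne
  have hcond : ∀ i ≤ n + 1, ENNReal.ofReal ((2 ^ i * r') ^ p) ≤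
      ENNReal.ofReal M * μ (ball x (2 ^ i * r')) := by
    intro i hi
    rw [← ofReal_measureReal (hfin x (2 ^ i * r')), ← ENNReal.ofReal_mul hM0.le]
    refine ENNReal.ofReal_le_ofReal (hM _ ?_ ?_)
    · exact hrr'.trans (le_mul_of_one_le_left hr'0.le (one_le_pow₀ (by norm_num)))
    · rw [← hNr]
      exact mul_le_mul_of_nonneg_right (pow_le_pow_right₀ (by norm_num) hi) hr'0.le
  set B : ℝ≥0∞ := ((n + 1 + 1 : ℕ) : ℝ≥0∞) ^ (p - 1) with hB
  have hBf : B ≠ ∞ := ENNReal.rpow_ne_top_of_nonneg (by linarith) (ENNReal.natCast_ne_top _)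
  set F : ℝ≥0∞ := K * (ENNReal.ofReal M * B) ^ (1 / p) with hF
  have hFf : F ≠ ∞ := ENNReal.mul_ne_top hK (ENNReal.rpow_ne_top_of_nonneg (by positivity)
    (ENNReal.mul_ne_top ENNReal.ofReal_ne_top hBf))
  have hF1 : 1 ≤ F * E ^ (1 / p) := by
    refine ENNReal.le_of_forall_pos_le_add fun ε hε _ => ?_
    obtain ⟨η, hη, hηF⟩ := ENNReal.exists_nnreal_pos_mul_lt hFf
      (b := (ε : ℝ≥0∞)) (by exact_mod_cast hε.ne')
    obtain ⟨h, hh, hhE⟩ := hw.exists_isUpperGradient (by linarith) (η := η)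
      (by exact_mod_cast hη.ne')
    rw [hEind] at hhE
    have := H r' R (n + 1) (ENNReal.ofReal M) hr'0 hNr hRR₀ hcond u h hui hh
      (fun y hy => hu.2.2 y (ball_subset_ball hr'r hy)) hu.2.1
    rw [← mul_assoc (ENNReal.ofReal M), ENNReal.mul_rpow_of_nonneg _ _ (by positivity),
      ← mul_assoc] at this
    calc 1 ≤ F * (∫⁻ y, h y ^ p ∂μ) ^ (1 / p) := this
      _ ≤ F * (E ^ (1 / p) + η) := by gcongr
      _ = F * E ^ (1 / p) + η * F := by ring
      _ ≤ _ := by gcongr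
  have hF2 : 1 ≤ K ^ p * (ENNReal.ofReal M * B) * E := by
    have := ENNReal.rpow_le_rpow hF1 hp0.le
    rwa [ENNReal.one_rpow, hF, ENNReal.mul_rpow_of_nonneg _ _ hp0.le,
      ENNReal.mul_rpow_of_nonneg _ _ hp0.le, ← ENNReal.rpow_mul, ← ENNReal.rpow_mul,
      one_div_mul_cancel hp0.ne', ENNReal.rpow_one, ENNReal.rpow_one] at this
  have hF3 : 1 ≤ K.toReal ^ p * (M * ((n + 1 + 1 : ℕ) : ℝ) ^ (p - 1)) * E.toReal := by
    have hne : K ^ p * (ENNReal.ofReal M * B) * E ≠ ∞ := ENNReal.mul_ne_top (ENNReal.mul_ne_top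
      (ENNReal.rpow_ne_top_of_nonneg hp0.le hK) (ENNReal.mul_ne_top ENNReal.ofReal_ne_top hBf)) hEf
    have := ENNReal.toReal_mono hne hF2
    rwa [ENNReal.toReal_one, ENNReal.toReal_mul, ENNReal.toReal_mul, ENNReal.toReal_mul, hB,
      ← ENNReal.toReal_rpow, ← ENNReal.toReal_rpow, ENNReal.toReal_natCast,
      ENNReal.toReal_ofReal hM0.le] at this
  rw [← ENNReal.ofReal_toReal hEf]
  refine ENNReal.ofReal_le_ofReal ?_
  have hlpow : l ^ (1 - p) = (l ^ (p - 1))⁻¹ := by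
    rw [← Real.rpow_neg hl0.le]; congr 1; ring
  have hlp : 0 < l ^ (p - 1) := Real.rpow_pos_of_pos hl0 _
  have e : (k * 8 ^ (p - 1))⁻¹ * (M⁻¹ * l ^ (1 - p)) = (k * (M * (8 * l) ^ (p - 1)))⁻¹ := by
    rw [hlpow, Real.mul_rpow (by norm_num) hl0.le, ← mul_inv, ← mul_inv]
    congr 1; ring
  rw [e, inv_le_iff_one_le_mul₀ (by positivity), mul_comm]
  refine hF3.trans (mul_le_mul_of_nonneg_right ?_ ENNReal.toReal_nonneg)
  have h1 : ((n + 1 + 1 : ℕ) : ℝ) ^ (p - 1) ≤ (8 * l) ^ (p - 1) :=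
    Real.rpow_le_rpow (by positivity) hcard (by linarith)
  have h2 : K.toReal ^ p ≤ k := by linarith
  gcongr

end LowerBound

/-! ### Power bounds for increasing functions of the radius. -/

section Growth

variable {f : ℝ → ℝ} {q C : ℝ}

/-- An upper power bound for ratios at radii at most `1` extends to radii at most `S`. -/
theorem exists_le_mul_rpow_mul_of_le_one (hpos : ∀ r, 0 < r → 0 < f r)
    (hmono : ∀ r s, 0 < r → r ≤ s → f r ≤ f s) (hq : 0 < q)
    (h : ∀ r R, 0 < r → r < R → R ≤ 1 → f r / f R ≤ C * (r / R) ^ q) (S : ℝ) :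
    ∃ C' : ℝ, 0 < C' ∧ ∀ r s, 0 < r → r ≤ s → s ≤ S → f r ≤ C' * (r / s) ^ q * f s := by
  set T := max S 1
  have hT1 : 1 ≤ T := le_max_right _ _
  have hT0 : 0 < T := by linarith
  have hf1 := hpos 1 one_pos
  have hfT := hpos T hT0
  refine ⟨f T / f 1 * (max C 1 * T ^ q), by positivity, fun r s hr hrs hsS => ?_⟩
  have hs : 0 < s := hr.trans_le hrs
  have hsT : s ≤ T := hsS.trans (le_max_left _ _)
  have hr' : 0 < min r 1 := lt_min hr one_pos
  have hs' : 0 < min s 1 := lt_min hs one_pos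
  have hfr' := hpos _ hr'
  have hfs' := hpos _ hs'
  -- Truncating the radii at 1 costs at most the factor f T / f 1 in `f` and, by `e3`, the factor T
  -- in the ratio of the radii.
  have e1 : f r ≤ f T / f 1 * f (min r 1) := by
    rcases le_total r 1 with h1 | h1
    · rw [min_eq_left h1]
      exact le_mul_of_one_le_left (hpos r hr).le
        ((one_le_div hf1).2 (hmono 1 T one_pos hT1))
    · rw [min_eq_right h1, div_mul_cancel₀ _ hf1.ne']
      exact hmono r T hr (hrs.trans hsT)
  have e2 : f (min r 1) ≤ max C 1 * (min r 1 / min s 1) ^ q * f (min s 1) := by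
    rcases (min_le_min_right 1 hrs).eq_or_lt with heq | hlt
    · rw [heq, div_self hs'.ne', Real.one_rpow, mul_one]
      exact le_mul_of_one_le_left hfs'.le (le_max_right _ _)
    · rw [← div_le_iff₀ hfs']
      refine (h _ _ hr' hlt (min_le_right _ _)).trans ?_
      gcongr
      exact le_max_left _ _
  have e3 : min r 1 / min s 1 ≤ T * (r / s) := by
    rw [div_le_iff₀ hs']
    have h2 : s / T ≤ min s 1 := le_min (div_le_self hs.le hT1) ((div_le_one hT0).2 hsT)
    calc min r 1 ≤ r := min_le_left _ _
      _ = T * (r / s) * (s / T) := by field_simp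
      _ ≤ T * (r / s) * min s 1 := by gcongr
  have e4 : f (min s 1) ≤ f s := hmono _ _ hs' (min_le_left _ _)
  calc f r ≤ f T / f 1 * f (min r 1) := e1
    _ ≤ f T / f 1 * (max C 1 * (T * (r / s)) ^ q * f s) := by
      gcongr
      exact e2.trans (by gcongr)
    _ = _ := by rw [Real.mul_rpow hT0.le (by positivity)]; ring

/-- A lower power bound for ratios at radii at most `1` extends to radii at most `S`. -/
theorem exists_mul_rpow_mul_le_of_le_one (hpos : ∀ r, 0 < r → 0 < f r)
    (hmono : ∀ r s, 0 < r → r ≤ s → f r ≤ f s) (hq : 0 < q) (hC : 0 < C)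
    (h : ∀ r R, 0 < r → r < R → R ≤ 1 → C * (r / R) ^ q ≤ f r / f R) (S : ℝ) :
    ∃ C' : ℝ, 0 < C' ∧ ∀ r s, 0 < r → r ≤ s → s ≤ S → C' * (r / s) ^ q * f s ≤ f r := by
  set T := max S 1
  have hT1 : 1 ≤ T := le_max_right _ _
  have hT0 : 0 < T := by linarith
  have hf1 := hpos 1 one_pos
  have hfT := hpos T hT0
  have hC1 : 0 < min C 1 := lt_min hC one_pos
  refine ⟨min C 1 * (f 1 / f T) * (T⁻¹) ^ q, by positivity, fun r s hr hrs hsS => ?_⟩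
  have hs : 0 < s := hr.trans_le hrs
  have hsT : s ≤ T := hsS.trans (le_max_left _ _)
  have hr' : 0 < min r 1 := lt_min hr one_pos
  have hs' : 0 < min s 1 := lt_min hs one_pos
  have hfr' := hpos _ hr'
  have hfs' := hpos _ hs'
  have hfs := hpos _ hs
  have e1 : f 1 / f T * f s ≤ f (min s 1) := by
    rcases le_total s 1 with h1 | h1
    · rw [min_eq_left h1]
      exact mul_le_of_le_one_left hfs.le
        ((div_le_one hfT).2 (hmono 1 T one_pos hT1))
    · rw [min_eq_right h1, div_mul_eq_mul_div, div_le_iff₀ hfT]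
      exact mul_le_mul_of_nonneg_left (hmono s T hs hsT) hf1.le
  have e2 : min C 1 * (min r 1 / min s 1) ^ q * f (min s 1) ≤ f (min r 1) := by
    rcases (min_le_min_right 1 hrs).eq_or_lt with heq | hlt
    · rw [heq, div_self hs'.ne', Real.one_rpow, mul_one]
      exact mul_le_of_le_one_left hfs'.le (min_le_right _ _)
    · rw [← le_div_iff₀ hfs']
      refine le_trans ?_ (h _ _ hr' hlt (min_le_right _ _))
      gcongr
      exact min_le_left _ _
  have e3 : T⁻¹ * (r / s) ≤ min r 1 / min s 1 := by
    rw [le_div_iff₀ hs']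
    have h2 : r / T ≤ min r 1 :=
      le_min (div_le_self hr.le hT1) ((div_le_one hT0).2 (hrs.trans hsT))
    calc T⁻¹ * (r / s) * min s 1 ≤ T⁻¹ * (r / s) * s := by gcongr; exact min_le_left _ _
      _ = r / T := by field_simp
      _ ≤ min r 1 := h2
  calc min C 1 * (f 1 / f T) * T⁻¹ ^ q * (r / s) ^ q * f s
      = min C 1 * (T⁻¹ * (r / s)) ^ q * (f 1 / f T * f s) := by
        rw [Real.mul_rpow (by positivity) (by positivity)]; ring
    _ ≤ min C 1 * (min r 1 / min s 1) ^ q * f (min s 1) := by gcongr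
    _ ≤ f (min r 1) := e2
    _ ≤ f r := hmono _ _ hr' (min_le_left _ _)

/-- Powers of the logarithm are dominated by any positive power. -/
theorem exists_log_rpow_le {a ε : ℝ} (ha : 0 < a) (hε : 0 < ε) :
    ∃ C : ℝ, 0 < C ∧ ∀ y, 1 ≤ y → Real.log y ^ a ≤ C * y ^ ε := by
  have hpos : 0 < ε / a := by positivity
  refine ⟨((ε / a) ^ a)⁻¹, by positivity, fun y hy => ?_⟩
  have h := Real.log_le_rpow_div (show 0 ≤ y by linarith) hpos
  refine (Real.rpow_le_rpow (Real.log_nonneg hy) h ha.le).trans (le_of_eq ?_)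
  rw [Real.div_rpow (by positivity) hpos.le, ← Real.rpow_mul (by linarith),
    div_mul_cancel₀ _ ha.ne', div_eq_inv_mul]

end Growth

theorem varCap_mono_left {X : Type*} [PseudoEMetricSpace X] [MeasurableSpace X] {μ : Measure X}
    {p : ℝ} {E E' Ω : Set X} (h : E ⊆ E') : varCap μ p E Ω ≤ varCap μ p E' Ω :=
  le_iInf₂ fun u hu => iInf₂_le u ⟨hu.1, hu.2.1, fun y hy => hu.2.2 y (h hy)⟩

/-! ### The upper capacity estimate with logarithm. -/

section UpperBound

variable {X : Type*} [PseudoMetricSpace X] [MeasurableSpace X] [BorelSpace X] {μ : Measure X}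
  {p : ℝ}

/-- Upper capacity estimate for annuli, with logarithmic dependence on the ratio of the radii. -/
theorem varCap_ball_le (hp : 1 < p) (x : X) (hfin : ∀ s, μ (ball x s) ≠ ∞) {r R M : ℝ}
    (hr : 0 < r) (hrR : 2 * r ≤ R)
    (hM : ∀ s, r ≤ s → 2 * s ≤ R → μ.real (ball x (2 * s)) ≤ M * s ^ p) :
    varCap μ p (ball x r) (ball x R) ≤
      ENNReal.ofReal (2 ^ (p - 1) * (M * Real.log (R / r) ^ (1 - p))) := by
  have hR0 : 0 < R := by linarith
  have hone : 1 ≤ R / r := by rw [one_le_div hr]; linarith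
  obtain ⟨N, hN1, hN2⟩ := exists_nat_pow_near hone (one_lt_two (α := ℝ))
  have hN : 0 < N := by
    rcases N.eq_zero_or_pos with rfl | h
    · rw [div_lt_iff₀ hr] at hN2
      norm_num at hN2
      linarith
    · exact h
  have hNR : 2 ^ N * r ≤ R := by rwa [le_div_iff₀ hr] at hN1
  have hM0 : 0 ≤ M := by
    have h1 := (measureReal_nonneg).trans (hM r le_rfl hrR)
    exact nonneg_of_mul_nonneg_left h1 (Real.rpow_pos_of_pos hr p)
  set l := Real.log (R / r) with hl
  have hl0 : 0 < l := Real.log_pos (by rw [lt_div_iff₀ hr]; linarith)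
  -- R/r < 2^(N+1) gives l ≤ (N + 1) log 2 ≤ N + 1 ≤ 2N.
  have hNl : l / 2 ≤ N := by
    have h1 := Real.log_le_log (by positivity) hN2.le
    rw [Real.log_pow] at h1
    have h2 : Real.log 2 ≤ 1 := by linarith [Real.log_two_lt_d9]
    have h3 : ((N + 1 : ℕ) : ℝ) * Real.log 2 ≤ (N + 1 : ℕ) * 1 := by gcongr
    have h4 : (1 : ℝ) ≤ N := by exact_mod_cast hN
    push_cast at h1 h3
    linarith
  refine (varCap_le_of_dyadic (by linarith) x hfin hr hN hNR (M := M) fun k hk => ?_).trans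
    (ENNReal.ofReal_le_ofReal ?_)
  · rw [div_le_iff₀ (by positivity), pow_succ', mul_assoc]
    refine hM _ (le_mul_of_one_le_left hr.le (one_le_pow₀ (by norm_num))) (le_trans ?_ hNR)
    rw [← mul_assoc, ← pow_succ']
    exact mul_le_mul_of_nonneg_right (pow_le_pow_right₀ (by norm_num) hk) hr.le
  · have h1 : (N : ℝ) ^ (1 - p) ≤ (l / 2) ^ (1 - p) :=
      Real.rpow_le_rpow_of_nonpos (by positivity) hNl (by linarith)
    have h2 : (l / 2) ^ (1 - p) = 2 ^ (p - 1) * l ^ (1 - p) := by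
      rw [Real.div_rpow hl0.le (by norm_num), div_eq_mul_inv, ← Real.rpow_neg (by norm_num),
        neg_sub, mul_comm]
    calc (N : ℝ) ^ (1 - p) * M ≤ (l / 2) ^ (1 - p) * M := by gcongr
      _ = _ := by rw [h2]; ring

end UpperBound

/-- This is how the bound on R₀ by a quarter of the diameter enters: the far point z makes the
annuli between s and 2s nonempty for all s ≤ R₀. -/
theorem exists_two_mul_le_dist_of_lt_ediam {X : Type*} [PseudoMetricSpace X] {R₀ : ℝ}
    (hR₀ : 0 < R₀) (h : ENNReal.ofReal R₀ < ediam (univ : Set X) / 4) (x : X) :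
    ∃ z, 2 * R₀ ≤ dist z x := by
  by_contra! hcon
  have hle : ediam (univ : Set X) ≤ ENNReal.ofReal (R₀ * 4) := by
    refine ediam_le fun a _ b _ => ?_
    rw [edist_dist]
    refine ENNReal.ofReal_le_ofReal ?_
    have := dist_triangle_right a b x
    linarith [hcon a, hcon b]
  refine absurd h (not_lt.2 ?_)
  refine ENNReal.div_le_of_le_mul (hle.trans (le_of_eq ?_))
  rw [ENNReal.ofReal_mul hR₀.le]
  norm_num

/-! ### From ratio bounds with a logarithm to pure power bounds. -/

section Converse

variable {f : ℝ → ℝ} {p R₀ c A : ℝ}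

/-- An upper power bound with a logarithmic factor yields power bounds for all smaller
exponents. -/
theorem exists_ratio_le_of_log (hpos : ∀ r, 0 < r → 0 < f r)
    (hmono : ∀ r s, 0 < r → r ≤ s → f r ≤ f s) (hp : 1 < p) (hR₀ : 0 < R₀) (hc : 0 < c)
    (hA : 0 < A)
    (h : ∀ r R, 0 < r → 2 * r ≤ R → R ≤ R₀ →
      c * (f r / r ^ p * Real.log (R / r) ^ (1 - p)) ≤ A * (f R / R ^ p))
    {q : ℝ} (hq : 0 < q) (hqp : q < p) :
    ∃ C : ℝ, 0 < C ∧ ∀ r R, 0 < r → r < R → R ≤ 1 → f r / f R ≤ C * (r / R) ^ q := by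
  -- The logarithm is absorbed by (R/r)^{p-q}, which lowers the exponent from p to q.
  obtain ⟨B, hB, hlog⟩ := exists_log_rpow_le (a := p - 1) (ε := p - q) (by linarith) (by linarith)
  have key : ∀ r R, 0 < r → r < R → R ≤ R₀ →
      f r / f R ≤ max (A / c * B) (2 ^ q) * (r / R) ^ q := by
    intro r R hr hrR hRR₀
    have hR : 0 < R := hr.trans hrR
    have hfr := hpos r hr
    have hfR := hpos R hR
    rcases le_total (2 * r) R with h2 | h2
    · have hl0 : 0 < Real.log (R / r) := Real.log_pos (by rw [lt_div_iff₀ hr]; linarith)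
      have h3 := h r R hr h2 hRR₀
      have hlp := Real.rpow_pos_of_pos hl0 (p - 1)
      have e1 : f r / f R ≤ A / c * (Real.log (R / r) ^ (p - 1) * (r / R) ^ p) := by
        rw [show (1 - p : ℝ) = -(p - 1) by ring, Real.rpow_neg hl0.le] at h3
        rw [Real.div_rpow hr.le hR.le]
        have hrp := Real.rpow_pos_of_pos hr p
        have hRp := Real.rpow_pos_of_pos hR p
        rw [div_le_iff₀ hfR]
        generalize Real.log (R / r) ^ (p - 1) = l at *
        calc f r = c * (f r / r ^ p * l⁻¹) * (r ^ p * l / c) := by field_simp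
          _ ≤ A * (f R / R ^ p) * (r ^ p * l / c) := by gcongr
          _ = _ := by field_simp
      refine e1.trans ?_
      have e2 := hlog (R / r) (by rw [one_le_div hr]; linarith)
      have e3 : (R / r) ^ (p - q) * (r / R) ^ p = (r / R) ^ q := by
        rw [← inv_div r R, Real.inv_rpow (by positivity), ← Real.rpow_neg (by positivity),
          ← Real.rpow_add (by positivity)]
        congr 1; ring
      calc A / c * (Real.log (R / r) ^ (p - 1) * (r / R) ^ p)
          ≤ A / c * (B * (R / r) ^ (p - q) * (r / R) ^ p) := by gcongr
        _ = A / c * B * (r / R) ^ q := by rw [← e3]; ring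
        _ ≤ _ := by gcongr; exact le_max_left _ _
    · calc f r / f R ≤ 1 := (div_le_one hfR).2 (hmono r R hr hrR.le)
        _ ≤ (2 * (r / R)) ^ q := Real.one_le_rpow (by
            rw [← mul_div_assoc, one_le_div hR]; exact h2) hq.le
        _ = 2 ^ q * (r / R) ^ q := Real.mul_rpow (by norm_num) (by positivity)
        _ ≤ _ := by gcongr; exact le_max_right _ _
  -- Rescaling by R₀ turns the range of radii up to R₀ into radii up to 1; the extension up to 1/R₀
  -- then reaches the original radius 1.
  obtain ⟨C', hC', H⟩ := exists_le_mul_rpow_mul_of_le_one (f := fun s => f (R₀ * s)) (q := q)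
    (fun r hr => hpos _ (by positivity))
    (fun r s hr hrs => hmono _ _ (by positivity) (mul_le_mul_of_nonneg_left hrs hR₀.le)) hq
    (fun r R hr hrR hR1 => by
      have := key (R₀ * r) (R₀ * R) (by positivity) (mul_lt_mul_of_pos_left hrR hR₀)
        (mul_le_of_le_one_right hR₀.le hR1)
      rwa [mul_div_mul_left _ _ hR₀.ne'] at this) (1 / R₀)
  refine ⟨C', hC', fun r R hr hrR hR1 => ?_⟩
  have := H (r / R₀) (R / R₀) (by positivity) (by gcongr) (by gcongr)
  rw [div_div_div_cancel_right₀ hR₀.ne'] at this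
  simp only [mul_div_cancel₀ _ hR₀.ne'] at this
  rwa [div_le_iff₀ (hpos R (hr.trans hrR))]

/-- A lower power bound with a logarithmic factor yields power bounds for all larger
exponents. -/
theorem exists_le_ratio_of_log (hpos : ∀ r, 0 < r → 0 < f r)
    (hmono : ∀ r s, 0 < r → r ≤ s → f r ≤ f s) {D : ℝ} (hD : 0 < D)
    (hdbl : ∀ r, 0 < r → f (2 * r) ≤ D * f r) (hp : 1 < p) (hR₀ : 0 < R₀) (hc : 0 < c)
    (hA : 0 < A)
    (h : ∀ r R, 0 < r → 2 * r ≤ R → R ≤ R₀ →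
      c * (f R / R ^ p * Real.log (R / r) ^ (1 - p)) ≤ A * (f r / r ^ p))
    {q : ℝ} (hqp : p < q) :
    ∃ C : ℝ, 0 < C ∧ ∀ r R, 0 < r → r < R → R ≤ 1 → C * (r / R) ^ q ≤ f r / f R := by
  obtain ⟨B, hB, hlog⟩ := exists_log_rpow_le (a := p - 1) (ε := q - p) (by linarith) (by linarith)
  have key : ∀ r R, 0 < r → r < R → R ≤ R₀ →
      min (c / A * B⁻¹) D⁻¹ * (r / R) ^ q ≤ f r / f R := by
    intro r R hr hrR hRR₀
    have hR : 0 < R := hr.trans hrR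
    have hfr := hpos r hr
    have hfR := hpos R hR
    rcases le_total (2 * r) R with h2 | h2
    · have hl0 : 0 < Real.log (R / r) := Real.log_pos (by rw [lt_div_iff₀ hr]; linarith)
      have h3 := h r R hr h2 hRR₀
      have hlp := Real.rpow_pos_of_pos hl0 (p - 1)
      have e2 := hlog (R / r) (by rw [one_le_div hr]; linarith)
      have e1 : c / A * ((Real.log (R / r) ^ (p - 1))⁻¹ * (r / R) ^ p) ≤ f r / f R := by
        rw [show (1 - p : ℝ) = -(p - 1) by ring, Real.rpow_neg hl0.le] at h3
        rw [Real.div_rpow hr.le hR.le]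
        have hrp := Real.rpow_pos_of_pos hr p
        have hRp := Real.rpow_pos_of_pos hR p
        rw [le_div_iff₀ hfR]
        generalize Real.log (R / r) ^ (p - 1) = l at *
        calc c / A * (l⁻¹ * (r ^ p / R ^ p)) * f R
            = c * (f R / R ^ p * l⁻¹) * (r ^ p / A) := by field_simp
          _ ≤ A * (f r / r ^ p) * (r ^ p / A) := by gcongr
          _ = _ := by field_simp
      refine le_trans ?_ e1
      have hpow : 0 < (R / r) ^ (q - p) := by positivity
      have e3 : ((R / r) ^ (q - p))⁻¹ * (r / R) ^ p = (r / R) ^ q := by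
        rw [← inv_div r R, Real.inv_rpow (by positivity), inv_inv,
          ← Real.rpow_add (by positivity)]
        congr 1; ring
      calc min (c / A * B⁻¹) D⁻¹ * (r / R) ^ q ≤ c / A * B⁻¹ * (r / R) ^ q := by
            gcongr; exact min_le_left _ _
        _ = c / A * ((B * (R / r) ^ (q - p))⁻¹ * (r / R) ^ p) := by rw [← e3, mul_inv]; ring
        _ ≤ _ := by gcongr
    · calc min (c / A * B⁻¹) D⁻¹ * (r / R) ^ q ≤ D⁻¹ * 1 := by
            gcongr
            · exact min_le_right _ _
            · exact Real.rpow_le_one (by positivity) ((div_le_one hR).2 hrR.le) (by linarith)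
        _ ≤ f r / f R := by
            rw [mul_one, le_div_iff₀ hfR, inv_mul_le_iff₀ hD]
            exact (hmono R (2 * r) hR h2).trans (hdbl r hr)
  obtain ⟨C', hC', H⟩ := exists_mul_rpow_mul_le_of_le_one (f := fun s => f (R₀ * s)) (q := q)
    (C := min (c / A * B⁻¹) D⁻¹)
    (fun r hr => hpos _ (by positivity))
    (fun r s hr hrs => hmono _ _ (by positivity) (mul_le_mul_of_nonneg_left hrs hR₀.le))
    (by linarith) (lt_min (by positivity) (by positivity))
    (fun r R hr hrR hR1 => by
      have := key (R₀ * r) (R₀ * R) (by positivity) (mul_lt_mul_of_pos_left hrR hR₀)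
        (mul_le_of_le_one_right hR₀.le hR1)
      rwa [mul_div_mul_left _ _ hR₀.ne'] at this) (1 / R₀)
  refine ⟨C', hC', fun r R hr hrR hR1 => ?_⟩
  have := H (r / R₀) (R / R₀) (by positivity) (by gcongr) (by gcongr)
  rw [div_div_div_cancel_right₀ hR₀.ne'] at this
  simp only [mul_div_cancel₀ _ hR₀.ne'] at this
  rwa [le_div_iff₀ (hpos R (hr.trans hrR))]

end Converse

/-! ### The capacity estimates and their converses. -/

theorem theorem1p2 {X : Type*} [MetricSpace X] [MeasurableSpace X] [BorelSpace X]
    (μ : Measure X)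
    (hball : ∀ (y : X) (r : ℝ), 0 < r → 0 < μ (ball y r) ∧ μ (ball y r) < ∞)
    (hdoubling : IsGloballyDoubling μ)
    (p₀ p : ℝ) (hp₀ : 1 ≤ p₀) (hp : p₀ < p) (hPoincare : SupportsPoincare μ p₀)
    (x : X) (R₀ : ℝ) (hR₀ : 0 < R₀)
    (hdiam : ENNReal.ofReal R₀ < ediam (univ : Set X) / 4) :
    -- the case `p = max lQ₀`
    (IsGreatest (lowerQZero μ x) p →
      (∃ c : ℝ, 0 < c ∧ CapLowerBound μ p x R₀ (fun r _ => r) c) ∧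
      (∃ C : ℝ, 0 < C ∧ CapUpperBound μ p x R₀ (fun _ R => R) C)) ∧
    -- the case `p = min uQ₀`
    (IsLeast (upperQZero μ x) p →
      (∃ c : ℝ, 0 < c ∧ CapLowerBound μ p x R₀ (fun _ R => R) c) ∧
      (∃ C : ℝ, 0 < C ∧ CapUpperBound μ p x R₀ (fun r _ => r) C)) ∧
    -- the converse statements
    ((∃ c : ℝ, 0 < c ∧ CapLowerBound μ p x R₀ (fun r _ => r) c) →
      (p : EReal) ≤ sSup ((fun q : ℝ => (q : EReal)) '' lowerQZero μ x)) ∧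
    ((∃ c : ℝ, 0 < c ∧ CapLowerBound μ p x R₀ (fun _ R => R) c) →
      sInf ((fun q : ℝ => (q : EReal)) '' upperQZero μ x) ≤ (p : EReal)) := by
  have hfin : ∀ (y : X) (s : ℝ), μ (ball y s) ≠ ∞ := fun y s => by
    rcases le_or_gt s 0 with hs | hs
    · simp [ball_eq_empty.2 hs]
    · exact (hball y s hs).2.ne
  have hp1 : 1 < p := by linarith
  set m : ℝ → ℝ := fun s => μ.real (ball x s) with hm
  have hpos : ∀ s, 0 < s → 0 < m s := fun s hs =>
    ENNReal.toReal_pos (hball x s hs).1.ne' (hfin x s)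
  have hmono : ∀ r s, 0 < r → r ≤ s → m r ≤ m s := fun r s _ hrs =>
    measureReal_mono (ball_subset_ball hrs) (hfin x s)
  obtain ⟨D, hD2, hD⟩ := hdoubling.exists_measureReal_ball_mul_le hfin 2
  have hD0 : 0 < D := by linarith
  have hdbl : ∀ r, 0 < r → m (2 * r) ≤ D * m r := fun r hr => hD x r hr
  obtain ⟨z, hz⟩ := exists_two_mul_le_dist_of_lt_ediam hR₀ hdiam x
  obtain ⟨c, hc, hlow⟩ := hPoincare.exists_le_varCap hball hdoubling hp₀ hp hz
  refine ⟨fun hmax => ?_, fun hmin => ?_, ?_, ?_⟩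
  · obtain ⟨-, C₀, -, hC₀⟩ := hmax.1
    obtain ⟨C, hC, hgrow⟩ := exists_le_mul_rpow_mul_of_le_one hpos hmono (by linarith) hC₀ (2 * R₀)
    refine ⟨⟨c * (C * D)⁻¹, by positivity, fun r R h2r hrR hRR₀ => ?_⟩,
      ⟨2 ^ (p - 1) * (C * 2 ^ p), by positivity, fun r R h2r hrR hRR₀ => ?_⟩⟩
    · have hr : 0 < r := by linarith
      have hmr := hpos r hr
      -- The radii s start at r/2, so the growth bound is based at r/2; D returns from m (r/2) to m
      -- r.
      refine le_trans (le_of_eq ?_) (hlow r R (C * D * (r ^ p / m r)) hr hrR hRR₀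
        (by positivity) fun s hs1 hs2 => ?_)
      · congr 1
        simp only [mul_inv, inv_div, hm]
        ring
      · have hs : 0 < s := by linarith
        have h1 := hgrow (r / 2) s (by positivity) hs1 (by linarith)
        have h2 := hdbl (r / 2) (by positivity)
        rw [mul_div_cancel₀ r two_ne_zero] at h2
        have h3 : (r / 2 / s) ^ p ≤ r ^ p / s ^ p := by
          rw [← Real.div_rpow hr.le hs.le]
          gcongr
          linarith
        have hsp : 0 < s ^ p := Real.rpow_pos_of_pos hs p
        have hms := hpos s hs
        have h4 : m r ≤ D * (C * (r ^ p / s ^ p) * m s) := h2.trans (by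
          gcongr
          exact h1.trans (by gcongr))
        calc s ^ p = m r * (s ^ p / m r) := by field_simp
          _ ≤ D * (C * (r ^ p / s ^ p) * m s) * (s ^ p / m r) := by gcongr
          _ = C * D * (r ^ p / m r) * m s := by field_simp
    · have hr : 0 < r := by linarith
      have hR : 0 < R := by linarith
      refine (varCap_ball_le hp1 x (hfin x) hr hrR (M := C * 2 ^ p * (m R / R ^ p))
        fun s hs1 hs2 => ?_).trans (le_of_eq ?_)
      · have hs : 0 < s := by linarith
        have h1 := hgrow (2 * s) R (by positivity) hs2 (by linarith)
        refine h1.trans (le_of_eq ?_)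
        rw [Real.div_rpow (by positivity) hR.le, Real.mul_rpow (by norm_num) hs.le]
        ring
      · congr 1
        simp only [hm]
        ring
  · obtain ⟨-, C₀, hC₀0, hC₀⟩ := hmin.1
    obtain ⟨C, hC, hgrow⟩ :=
      exists_mul_rpow_mul_le_of_le_one hpos hmono (by linarith) hC₀0 hC₀ (2 * R₀)
    refine ⟨⟨c * (C⁻¹ * 2 ^ p)⁻¹, by positivity, fun r R h2r hrR hRR₀ => ?_⟩,
      ⟨2 ^ (p - 1) * (D * C⁻¹), by positivity, fun r R h2r hrR hRR₀ => ?_⟩⟩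
    · have hr : 0 < r := by linarith
      have hR : 0 < R := by linarith
      have hmR := hpos R hR
      -- The radii s reach 2R, so the growth bound is taken against 2R; this produces 2^p, and m R ≤
      -- m (2 * R).
      refine le_trans (le_of_eq ?_) (hlow r R (C⁻¹ * 2 ^ p * (R ^ p / m R)) hr hrR hRR₀
        (by positivity) fun s hs1 hs2 => ?_)
      · congr 1
        simp only [mul_inv, inv_div, hm]
        ring
      · have hs : 0 < s := by linarith
        have h1 := hgrow s (2 * R) hs hs2 (by linarith)
        rw [Real.div_rpow hs.le (by positivity), Real.mul_rpow (by norm_num) hR.le] at h1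
        have hRp : 0 < R ^ p := Real.rpow_pos_of_pos hR p
        have h2p : (0 : ℝ) < 2 ^ p := by positivity
        calc s ^ p = C⁻¹ * 2 ^ p * (R ^ p / m R) * (C * (s ^ p / (2 ^ p * R ^ p)) * m R) := by
              field_simp
          _ ≤ C⁻¹ * 2 ^ p * (R ^ p / m R) * (C * (s ^ p / (2 ^ p * R ^ p)) * m (2 * R)) := by
              gcongr
              exact hmono R (2 * R) hR (by linarith)
          _ ≤ C⁻¹ * 2 ^ p * (R ^ p / m R) * m s := by gcongr
    · have hr : 0 < r := by linarith
      refine (varCap_ball_le hp1 x (hfin x) hr hrR (M := D * C⁻¹ * (m r / r ^ p))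
        fun s hs1 hs2 => ?_).trans (le_of_eq ?_)
      · have hs : 0 < s := by linarith
        have h1 := hgrow r s hr hs1 (by linarith)
        rw [Real.div_rpow hr.le hs.le] at h1
        have hrp : 0 < r ^ p := Real.rpow_pos_of_pos hr p
        have hsp : 0 < s ^ p := Real.rpow_pos_of_pos hs p
        calc m (2 * s) ≤ D * m s := hdbl s hs
          _ = D * C⁻¹ * (C * (r ^ p / s ^ p) * m s / r ^ p) * s ^ p := by field_simp
          _ ≤ D * C⁻¹ * (m r / r ^ p) * s ^ p := by gcongr
      · congr 1
        simp only [hm]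
        ring
  · rintro ⟨a, ha, hcap⟩
    rw [← EReal.ge_of_forall_gt_iff_ge]
    intro q hq
    rw [EReal.coe_lt_coe_iff] at hq
    -- Exponents must be positive while q is any real below p; the maximum with p/2 stays in (0, p).
    have hmem : max q (p / 2) ∈ lowerQZero μ x := by
      have hq0 : 0 < max q (p / 2) := lt_max_of_lt_right (by linarith)
      refine ⟨hq0, exists_ratio_le_of_log hpos hmono hp1 hR₀ ha (A := 2 ^ p) (by positivity)
        (fun r R hr hrR hRR₀ => ?_) hq0 (max_lt hq (by linarith))⟩
      have hR : 0 < R := by linarith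
      have h1 := hcap r R (by linarith) hrR hRR₀
      -- A single annulus next to the outer sphere bounds cap_p(B_{R/2}, B_R), and so cap_p(B_r,
      -- B_R), by a quantity depending only on R.
      have h2 := varCap_le_of_dyadic (μ := μ) (p := p) (by linarith) x (hfin x) (r := R / 2)
        (R := R) (M := 2 ^ p * (m R / R ^ p)) (by positivity) one_pos
        (by rw [pow_one, mul_div_cancel₀ R two_ne_zero]) fun k hk => by
          obtain rfl : k = 0 := by omega
          rw [zero_add, pow_one, pow_zero, one_mul, mul_div_cancel₀ R two_ne_zero,
            Real.div_rpow hR.le (by norm_num)]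
          apply le_of_eq
          simp only [hm]
          field_simp
      have h3 := h1.trans ((varCap_mono_left (ball_subset_ball (by linarith))).trans h2)
      rw [Nat.cast_one, Real.one_rpow, one_mul] at h3
      have hmR := hpos R hR
      exact (ENNReal.ofReal_le_ofReal_iff (by positivity)).1 h3
    refine le_trans (EReal.coe_le_coe_iff.2 (le_max_left q (p / 2))) (le_sSup ⟨_, hmem, rfl⟩)
  · rintro ⟨a, ha, hcap⟩
    rw [← EReal.le_of_forall_lt_iff_le]
    intro q hq
    rw [EReal.coe_lt_coe_iff] at hq
    refine sInf_le ⟨q, ⟨by linarith, exists_le_ratio_of_log hpos hmono hD0 hdbl hp1 hR₀ ha hD0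
      (fun r R hr hrR hRR₀ => ?_) hq⟩, rfl⟩
    have h1 := hcap r R (by linarith) hrR hRR₀
    -- Here the single annulus sits next to the inner ball, so the bound depends only on r.
    have h2 := varCap_le_of_dyadic (μ := μ) (p := p) (by linarith) x (hfin x) (r := r)
      (R := R) (M := D * (m r / r ^ p)) hr one_pos (by rwa [pow_one]) fun k hk => by
        obtain rfl : k = 0 := by omega
        rw [zero_add, pow_one, pow_zero, one_mul, ← mul_div_assoc]
        gcongr
        exact hdbl r hr
    have h3 := h1.trans h2
    rw [Nat.cast_one, Real.one_rpow, one_mul] at h3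
    have hmr := hpos r hr
    exact (ENNReal.ofReal_le_ofReal_iff (by positivity)).1 h3
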